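/- Consider the distance query model: the vertex set $[n]=\{1,\dots,n\}$ of a hidden graph $G$ is known, and an algorithm may adaptively (and using randomness independent of $G$) ask queries; a query names two vertices $u,v$ and is answered by their distance $d_G(u,v)$ in $G$ (which is $\infty$ if $u$ and $v$ lie in different components). An algorithm reconstructs the graph if its output is always equal to $G$, for every hidden graph $G$ on $[n]$ and every outcome of its random choices. Let $G(n,p)$ denote the random graph on $[n]$ in which each pair of vertices is an edge independently with probability $p$, and let $\log$ be the natural logarithm. There is an absolute constant $C>0$ such that for every integer $n\ge 1$ and every $p\in\left[\frac{2000\log n}{n},\frac{\log^2 n}{n}\right]$ there exists an algorithm (which may depend on $n$ and $p$) that reconstructs the graph and whose expected number of queries on $G\sim G(n,p)$, the expectation being over both $G$ and the random choices of the algorithm, is at most $C\,n\log^5 n$. -/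

import Mathlib

open scoped ENNReal

/-- A deterministic adaptive algorithm in the distance query model on a known vertex set `V`:
it either stops and outputs a graph on `V`, or it asks for the distance between two vertices and
continues in a way that depends on the answer (`⊤` stands for the distance between two vertices in
different components). Such a tree is well-founded, so every run asks finitely many queries. -/
inductive DistanceQueryAlgorithm (V : Type) : Type where
  | output (H : SimpleGraph V) : DistanceQueryAlgorithm V
  | query (u v : V) (next : ℕ∞ → DistanceQueryAlgorithm V) : DistanceQueryAlgorithm V

namespace DistanceQueryAlgorithm

variable {V : Type}

/-- The graph that the algorithm outputs when the oracle answers distances in the hidden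
graph `G`. -/
noncomputable def run (G : SimpleGraph V) : DistanceQueryAlgorithm V → SimpleGraph V
  | output H => H
  | query u v next => run G (next (G.edist u v))

/-- The number of queries that the algorithm asks when the hidden graph is `G`. -/
noncomputable def numQueries (G : SimpleGraph V) : DistanceQueryAlgorithm V → ℕ
  | output _ => 0
  | query u v next => numQueries G (next (G.edist u v)) + 1

end DistanceQueryAlgorithm

/-- A randomized algorithm in the distance query model: a probability distribution on deterministic
algorithms (all random choices are drawn independently of the hidden graph). -/
abbrev RandomizedDistanceQueryAlgorithm (V : Type) : Type :=
  PMF (DistanceQueryAlgorithm V)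

namespace RandomizedDistanceQueryAlgorithm

variable {V : Type}

/-- The randomized algorithm reconstructs the graph without error: whatever the hidden graph and
whatever the random choices, the output is the hidden graph. -/
def Reconstructs (A : RandomizedDistanceQueryAlgorithm V) : Prop :=
  ∀ D ∈ A.support, ∀ G : SimpleGraph V, D.run G = G

/-- The expected number of queries when the hidden graph has distribution `μ`, the expectation being
over both the hidden graph and the (independent) random choices of the algorithm. -/
noncomputable def expectedQueries (A : RandomizedDistanceQueryAlgorithm V)
    (μ : MeasureTheory.Measure (SimpleGraph V)) : ℝ≥0∞ :=
  ∑' D : DistanceQueryAlgorithm V, A D * ∫⁻ G, (D.numQueries G : ℝ≥0∞) ∂μ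

end RandomizedDistanceQueryAlgorithm

/-! Fix landmarks, query every vertex against every landmark, and then query every pair whose
distances to each landmark differ by at most one. Adjacent vertices always pass this test, so the
output is correct for every graph and every choice of landmarks; only the number of surviving pairs
is random.

Write `L = log n` and `d = np`, and let `k` be maximal with `40 * d ^ (k + 1) ≤ n`. The main
estimate, `measureReal_few_closerByTwo_le`, says that for fixed `u ≠ v`, outside an event of
probability at most `1 / n`, either `u` and `v` are adjacent or at least `d ^ k / 2` vertices are at
finite distance from `u` and closer to `u` than to `v` by at least two. As a landmark, any such
vertex eliminates the pair. Since `d ≤ L ^ 2`, they form a fraction at least `1 / (80 * L ^ 4)` of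
all vertices, so about `80 * L ^ 5` uniform landmarks all miss them with probability at most `1 /
n`. Averaging (`exists_landmarks_sum_le`) gives one fixed choice of landmarks with at most `n ^ 2 *
(p + 2 / n)` expected surviving pairs, so a deterministic algorithm suffices.

For the main estimate, breadth-first searches from `u` and `v` run together, the one from `v` a step
ahead and with first claim on new vertices. What the search from `u` still obtains is closer to `u`
by two (`ExploreInvariant.mem_explore`). Each round exposes only fresh edges, so Chernoff bounds
show that the `u`-layer grows by a factor of about `d` (`measureReal_not_layerSizes_step_le`);
collisions cost little while the layers are small compared with `n`. -/

/-! ### Independence of events on disjoint edge sets, and deferred decisions. -/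

section RandomGraph

open MeasureTheory ProbabilityTheory SimpleGraph unitInterval

variable {V : Type*}

/-- An event about graphs on `V` that is determined by the edges in `F`. -/
def EventDependsOn (F : Set (Sym2 V)) (E : Set (SimpleGraph V)) : Prop :=
  ∀ G H : SimpleGraph V, (∀ e ∈ F, e ∈ G.edgeSet ↔ e ∈ H.edgeSet) → G ∈ E → H ∈ E

theorem EventDependsOn.mem_iff {F : Set (Sym2 V)} {E : Set (SimpleGraph V)}
    (h : EventDependsOn F E) {G H : SimpleGraph V}
    (hGH : ∀ e ∈ F, e ∈ G.edgeSet ↔ e ∈ H.edgeSet) : G ∈ E ↔ H ∈ E :=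
  ⟨h G H hGH, h H G fun e he => (hGH e he).symm⟩

theorem EventDependsOn.mono {F F' : Set (Sym2 V)} {E : Set (SimpleGraph V)}
    (h : EventDependsOn F E) (hF : F ⊆ F') : EventDependsOn F' E :=
  fun G H hGH => h G H fun e he => hGH e (hF he)

theorem EventDependsOn.compl {F : Set (Sym2 V)} {E : Set (SimpleGraph V)}
    (h : EventDependsOn F E) : EventDependsOn F Eᶜ :=
  fun _ _ hGH hG hH => hG ((h.mem_iff hGH).2 hH)

theorem EventDependsOn.inter {F : Set (Sym2 V)} {E E' : Set (SimpleGraph V)}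
    (h : EventDependsOn F E) (h' : EventDependsOn F E') : EventDependsOn F (E ∩ E') :=
  fun _ _ hGH hG => ⟨h _ _ hGH hG.1, h' _ _ hGH hG.2⟩

theorem eventDependsOn_adj (a b : V) : EventDependsOn {s(a, b)} {G : SimpleGraph V | G.Adj a b} := by
  intro G H h hG
  have := h s(a, b) rfl
  simpa using this.1 (by simpa using hG)

variable [Fintype V]

instance : MeasurableSingletonClass (SimpleGraph V) where
  measurableSet_singleton G := by
    rw [← measurableEmbedding_edgeSet.measurableSet_image]
    exact Set.toFinite _ |>.measurableSet

/-- The product measure on indicator functions of edges. -/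
noncomputable def edgeMeasure (V : Type*) (p : I) : Measure (Sym2 V → Prop) :=
  Measure.infinitePi fun e : Sym2 V =>
    toNNReal p • Measure.dirac (e ∈ (Sym2.diagSetᶜ : Set (Sym2 V))) +
      toNNReal (σ p) • Measure.dirac False

instance (p : I) : IsProbabilityMeasure (edgeMeasure V p) := by
  unfold edgeMeasure; infer_instance

theorem binomialRandom_eq_map_edgeMeasure (p : I) :
    binomialRandom V p = (edgeMeasure V p).map (fun P => fromEdgeSet {e | P e}) := by
  rw [binomialRandom_eq_map, setBernoulli_eq_map, Measure.map_map .of_discrete .of_discrete]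
  rfl

/-- Pulled back to the product measure, an event depending on `F` factors through the restriction to
the coordinates in `F`, and disjoint blocks of coordinates are independent. -/
theorem binomialRandom_inter {p : I} {F F' : Set (Sym2 V)} {E E' : Set (SimpleGraph V)}
    (hF : Disjoint F F') (hE : EventDependsOn F E) (hE' : EventDependsOn F' E') :
    binomialRandom V p (E ∩ E') = binomialRandom V p E * binomialRandom V p E' := by
  classical
  have key : ∀ (S : Finset (Sym2 V)) (D : Set (SimpleGraph V)), EventDependsOn (S : Set (Sym2 V)) D →
      (fun P : Sym2 V → Prop => fromEdgeSet {e | P e}) ⁻¹' D =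
        (fun P (e : S) => P e) ⁻¹'
          {r : S → Prop | ∃ P : Sym2 V → Prop, (fun e : S => P e) = r ∧ fromEdgeSet {e | P e} ∈ D} := by
    intro S D hD
    ext P
    constructor
    · intro h
      exact ⟨P, rfl, h⟩
    · rintro ⟨Q, hQ, h⟩
      refine hD _ _ ?_ h
      intro e he
      have := congrFun hQ ⟨e, he⟩
      simp only at this
      simp [this]
  have hind : iIndepFun (fun (e : Sym2 V) (P : Sym2 V → Prop) => P e) (edgeMeasure V p) := by
    unfold edgeMeasure
    exact iIndepFun_infinitePi (X := fun _ x => x) (fun _ => measurable_id)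
  have h2 := hind.indepFun_finset F.toFinset F'.toFinset (by simpa using hF)
    (fun e => measurable_pi_apply e)
  rw [binomialRandom_eq_map_edgeMeasure]
  rw [Measure.map_apply .of_discrete .of_discrete, Measure.map_apply .of_discrete .of_discrete,
    Measure.map_apply .of_discrete .of_discrete, Set.preimage_inter,
    key F.toFinset E (by simpa using hE), key F'.toFinset E' (by simpa using hE')]
  exact h2.measure_inter_preimage_eq_mul _ _ .of_discrete .of_discrete

theorem binomialRandom_adj {p : I} {a b : V} (h : a ≠ b) :
    (binomialRandom V p).real {G | G.Adj a b} = p := by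
  rw [binomialRandom_eq_map_edgeMeasure, measureReal_def, Measure.map_apply .of_discrete .of_discrete]
  have : (fun P : Sym2 V → Prop => fromEdgeSet {e | P e}) ⁻¹' {G | G.Adj a b} =
      (fun P => P s(a, b)) ⁻¹' {True} := by
    ext P; simp [h]
  rw [this, ← Measure.map_apply (measurable_pi_apply _) .of_discrete, edgeMeasure,
    Measure.infinitePi_map_eval]
  simp [h]

theorem binomialRandom_iIndepSet {p : I} {ι : Type*} {F : ι → Set (Sym2 V)}
    {E : ι → Set (SimpleGraph V)} (hF : Pairwise (Function.onFun Disjoint F))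
    (hE : ∀ i, EventDependsOn (F i) (E i)) : iIndepSet E (binomialRandom V p) := by
  classical
  rw [iIndepSet_iff_meas_biInter (fun i => .of_discrete)]
  intro s
  induction s using Finset.induction_on with
  | empty => simp
  | insert i s hi ih =>
    rw [Finset.prod_insert hi, ← ih, Finset.set_biInter_insert]
    refine binomialRandom_inter (F' := ⋃ j ∈ s, F j) ?_ (hE i) ?_
    · simp only [Set.disjoint_iUnion_right]
      intro j hj
      exact hF (by rintro rfl; exact hi hj)
    · intro G H hGH hG
      simp only [Set.mem_iInter] at hG ⊢
      exact fun j hj => hE j G H (fun e he => hGH e (by simp; exact ⟨j, hj, he⟩)) (hG j hj)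

/-- Deferred decisions: `T` is what has been exposed on `F`, and `Q` is the set of good outcomes.
Given `T G = t`, the edges in `F'` are still fresh, so `E t` keeps its unconditional probability.
This drives the round-by-round analysis of the search. -/
theorem binomialRandom_bind_le {p : I} {τ : Type*} [Fintype τ] {F F' : Set (Sym2 V)}
    (hF : Disjoint F F') {T : SimpleGraph V → τ}
    (hT : ∀ t, EventDependsOn F {G | T G = t}) (E : τ → Set (SimpleGraph V)) (Q : Set τ) {δ : ℝ}
    (hδ : 0 ≤ δ) (hE : ∀ t ∈ Q, (∃ G, T G = t) →
      EventDependsOn F' (E t) ∧ (binomialRandom V p).real (E t) ≤ δ) :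
    (binomialRandom V p).real {G | G ∈ E (T G)} ≤ (binomialRandom V p).real {G | T G ∉ Q} + δ := by
  classical
  set μ := binomialRandom V p
  have hsub : {G | G ∈ E (T G)} ⊆
      {G | T G ∉ Q} ∪ ⋃ t ∈ (Finset.univ.filter (· ∈ Q)), ({G | T G = t} ∩ E t) := by
    intro G hG
    by_cases h : T G ∈ Q
    · right; simp only [Set.mem_iUnion]; exact ⟨T G, by simpa using h, rfl, hG⟩
    · left; exact h
  calc μ.real {G | G ∈ E (T G)} ≤ _ := measureReal_mono hsub
    _ ≤ _ := measureReal_union_le _ _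
    _ ≤ μ.real {G | T G ∉ Q} + δ := ?_
  gcongr
  calc _ ≤ ∑ t ∈ Finset.univ.filter (· ∈ Q), μ.real ({G | T G = t} ∩ E t) :=
        measureReal_biUnion_finset_le _ _
    _ ≤ ∑ t ∈ Finset.univ.filter (· ∈ Q), μ.real {G | T G = t} * δ := by
        refine Finset.sum_le_sum fun t ht => ?_
        by_cases h : ∃ G, T G = t
        · obtain ⟨h1, h2⟩ := hE t (by simpa using ht) h
          rw [measureReal_def, binomialRandom_inter hF (hT t) h1, ENNReal.toReal_mul]
          exact mul_le_mul_of_nonneg_left h2 measureReal_nonneg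
        · have : {G | T G = t} = ∅ := by
            ext G; simp only [Set.mem_ofPred_eq, Set.mem_empty_iff_false, iff_false]
            exact fun hG => h ⟨G, hG⟩
          simp [this]
    _ ≤ ∑ t, μ.real {G | T G = t} * δ :=
        Finset.sum_le_sum_of_subset_of_nonneg (Finset.filter_subset _ _)
          fun _ _ _ => mul_nonneg measureReal_nonneg hδ
    _ = (∑ t, μ.real {G | T G = t}) * δ := by rw [Finset.sum_mul]
    _ = δ := by
        have := measureReal_biUnion_finset (μ := μ) (s := (Finset.univ : Finset τ))
          (f := fun t => {G | T G = t})
          (fun i _ j _ hij => Set.disjoint_left.2 fun G h1 h2 => hij (h1.symm.trans h2))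
          (fun t _ => .of_discrete)
        rw [← this]
        have hu : (⋃ t ∈ (Finset.univ : Finset τ), {G | T G = t}) = Set.univ := by
          ext G; simp
        rw [hu]; simp

end RandomGraph

/-! ### Chernoff bounds for counts of independent events. -/

section Chernoff

open MeasureTheory ProbabilityTheory

variable {Ω ι : Type*} [MeasurableSpace Ω] {μ : Measure Ω} [IsProbabilityMeasure μ]

theorem mgf_indicator_one {E : Set Ω} (hE : MeasurableSet E) (t : ℝ) :
    mgf (E.indicator 1) μ t = 1 + (Real.exp t - 1) * μ.real E := by
  have : (fun ω => Real.exp (t * E.indicator (1 : Ω → ℝ) ω)) =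
      fun ω => 1 + E.indicator (fun _ => Real.exp t - 1) ω := by
    ext ω
    by_cases h : ω ∈ E <;> simp [h]
  rw [mgf, this, integral_add (integrable_const _) ((integrable_const _).indicator hE),
    integral_indicator hE]
  simp [mul_comm]

theorem mgf_sum_indicator {E : ι → Set Ω} (hE : ∀ i, MeasurableSet (E i)) (hi : iIndepSet E μ)
    (R : Finset ι) (t : ℝ) :
    mgf (∑ i ∈ R, (E i).indicator 1) μ t = ∏ i ∈ R, (1 + (Real.exp t - 1) * μ.real (E i)) := by
  have h1 : iIndepFun (fun i => (E i).indicator (1 : Ω → ℝ)) μ := hi.iIndepFun_indicator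
  rw [h1.mgf_sum (fun i => measurable_one.indicator (hE i))]
  exact Finset.prod_congr rfl fun i _ => mgf_indicator_one (hE i) t

theorem integrable_exp_mul_sum_indicator {E : ι → Set Ω} (hE : ∀ i, MeasurableSet (E i))
    (R : Finset ι) (t : ℝ) :
    Integrable (fun ω => Real.exp (t * (∑ i ∈ R, (E i).indicator (1 : Ω → ℝ)) ω)) μ := by
  refine Integrable.of_bound (C := Real.exp (|t| * R.card)) ?_ (.of_forall fun ω => ?_)
  · refine Measurable.aestronglyMeasurable ?_
    refine Real.measurable_exp.comp (Measurable.const_mul ?_ _)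
    have h := Finset.measurable_sum R fun i _ =>
      (measurable_const (a := (1 : ℝ))).indicator (hE i)
    convert h using 1
    ext ω
    simp only [Finset.sum_apply]
    rfl
  · rw [Real.norm_eq_abs, Real.abs_exp, Real.exp_le_exp]
    refine (le_abs_self _).trans ?_
    rw [abs_mul]
    refine mul_le_mul_of_nonneg_left ?_ (abs_nonneg _)
    rw [Finset.sum_apply]
    refine (Finset.abs_sum_le_sum_abs _ _).trans ?_
    refine (Finset.sum_le_card_nsmul R _ 1 fun i _ => ?_).trans (by simp)
    by_cases h : ω ∈ E i <;> simp [h]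

open scoped Classical in
theorem sum_indicator_apply_eq_card {Ω ι : Type*} {E : ι → Set Ω} (R : Finset ι) (ω : Ω) :
    (∑ i ∈ R, (E i).indicator (1 : Ω → ℝ)) ω = (R.filter fun i => ω ∈ E i).card := by
  simp [Finset.sum_apply, Set.indicator_apply, Finset.sum_boole]

open scoped Classical in
/-- Chernoff bound for the upper tail of the number of independent events that occur. -/
theorem measureReal_card_ge_le {E : ι → Set Ω} (hE : ∀ i, MeasurableSet (E i))
    (hi : iIndepSet E μ) {R : Finset ι} {q m ε : ℝ} (hq : ∀ i ∈ R, μ.real (E i) ≤ q)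
    (hm : q * R.card ≤ m) (hε : 0 ≤ ε) (hε1 : ε ≤ 1) :
    μ.real {ω | (1 + ε) * m ≤ (R.filter fun i => ω ∈ E i).card} ≤ Real.exp (-(ε ^ 2 * m / 4)) := by
  -- The exponential parameter is `ε / 2`; with this second-order bound the exponent becomes exactly
  -- `-(ε ^ 2 * m / 4)`.
  have hexp : Real.exp (ε / 2) - 1 ≤ ε / 2 + (ε / 2) ^ 2 := by
    have := abs_le.1 (Real.abs_exp_sub_one_sub_id_le (x := ε / 2) (by rw [abs_le]; constructor <;> linarith))
    linarith [this.2]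
  have hexp0 : 0 ≤ Real.exp (ε / 2) - 1 := by linarith [Real.add_one_le_exp (ε / 2)]
  have hch := measure_ge_le_exp_mul_mgf (X := ∑ i ∈ R, (E i).indicator (1 : Ω → ℝ)) (μ := μ)
    ((1 + ε) * m) (t := ε / 2) (by linarith) (integrable_exp_mul_sum_indicator hE R _)
  simp only [sum_indicator_apply_eq_card] at hch
  refine hch.trans ?_
  rw [mgf_sum_indicator hE hi]
  have hprod : ∏ i ∈ R, (1 + (Real.exp (ε / 2) - 1) * μ.real (E i)) ≤
      Real.exp ((Real.exp (ε / 2) - 1) * m) := by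
    calc _ ≤ ∏ i ∈ R, Real.exp ((Real.exp (ε / 2) - 1) * q) := by
          refine Finset.prod_le_prod (fun i _ => by positivity) fun i hiR => ?_
          rw [add_comm]
          refine (Real.add_one_le_exp _).trans (Real.exp_le_exp.2 ?_)
          exact mul_le_mul_of_nonneg_left (hq i hiR) hexp0
      _ = Real.exp ((Real.exp (ε / 2) - 1) * (q * R.card)) := by
          rw [Finset.prod_const, ← Real.exp_nat_mul]; ring_nf
      _ ≤ _ := Real.exp_le_exp.2 (mul_le_mul_of_nonneg_left hm hexp0)
  have hm0 : 0 ≤ m := by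
    rcases R.eq_empty_or_nonempty with rfl | ⟨i, hiR⟩
    · simpa using hm
    · exact (mul_nonneg (measureReal_nonneg.trans (hq i hiR)) (Nat.cast_nonneg _)).trans hm
  calc _ ≤ Real.exp (-(ε / 2) * ((1 + ε) * m)) * Real.exp ((Real.exp (ε / 2) - 1) * m) := by
        gcongr
    _ ≤ _ := by
        rw [← Real.exp_add, Real.exp_le_exp]
        nlinarith [mul_le_mul_of_nonneg_right hexp hm0]

open scoped Classical in
/-- Chernoff bound for the lower tail of the number of independent events that occur. -/
theorem measureReal_card_le_le {E : ι → Set Ω} (hE : ∀ i, MeasurableSet (E i))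
    (hi : iIndepSet E μ) {R : Finset ι} {q m ε : ℝ} (hq : ∀ i ∈ R, q ≤ μ.real (E i))
    (hm : m ≤ q * R.card) (hm0 : 0 ≤ m) (hε : 0 ≤ ε) (hε1 : ε ≤ 1) :
    μ.real {ω | ((R.filter fun i => ω ∈ E i).card : ℝ) ≤ (1 - ε) * m} ≤
      Real.exp (-(ε ^ 2 * m / 4)) := by
  have hexp : Real.exp (-(ε / 2)) - 1 ≤ -(ε / 2) + (ε / 2) ^ 2 := by
    have := abs_le.1 (Real.abs_exp_sub_one_sub_id_le (x := -(ε / 2))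
      (by rw [abs_le]; constructor <;> linarith))
    nlinarith [this.2]
  have hexp0 : Real.exp (-(ε / 2)) - 1 ≤ 0 := by
    have : Real.exp (-(ε / 2)) ≤ 1 := Real.exp_le_one_iff.2 (by linarith)
    linarith
  have hch := measure_le_le_exp_mul_mgf (X := ∑ i ∈ R, (E i).indicator (1 : Ω → ℝ)) (μ := μ)
    ((1 - ε) * m) (t := -(ε / 2)) (by linarith) (integrable_exp_mul_sum_indicator hE R _)
  simp only [sum_indicator_apply_eq_card] at hch
  refine hch.trans ?_
  rw [mgf_sum_indicator hE hi]
  have hprod : ∏ i ∈ R, (1 + (Real.exp (-(ε / 2)) - 1) * μ.real (E i)) ≤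
      Real.exp ((Real.exp (-(ε / 2)) - 1) * m) := by
    calc _ ≤ ∏ i ∈ R, Real.exp ((Real.exp (-(ε / 2)) - 1) * q) := by
          refine Finset.prod_le_prod (fun i _ => ?_) fun i hiR => ?_
          · have h1 : μ.real (E i) ≤ 1 := measureReal_le_one
            have h0 : 0 ≤ μ.real (E i) := measureReal_nonneg
            nlinarith [Real.exp_pos (-(ε / 2))]
          · rw [add_comm]
            refine (Real.add_one_le_exp _).trans (Real.exp_le_exp.2 ?_)
            exact mul_le_mul_of_nonpos_left (hq i hiR) hexp0
      _ = Real.exp ((Real.exp (-(ε / 2)) - 1) * (q * R.card)) := by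
          rw [Finset.prod_const, ← Real.exp_nat_mul]; ring_nf
      _ ≤ _ := Real.exp_le_exp.2 (mul_le_mul_of_nonpos_left hm hexp0)
  calc _ ≤ Real.exp (-(-(ε / 2)) * ((1 - ε) * m)) * Real.exp ((Real.exp (-(ε / 2)) - 1) * m) := by
        gcongr
    _ ≤ _ := by
        rw [← Real.exp_add, Real.exp_le_exp]
        nlinarith [mul_le_mul_of_nonneg_right hexp hm0]

end Chernoff

/-! ### The simultaneous search and its deterministic invariant. -/

section Exploration

open SimpleGraph

variable {V : Type*}

/-- `u` is closer to `x` than `v` by at least two. -/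
def CloserByTwo (G : SimpleGraph V) (u v x : V) : Prop :=
  G.edist u x + 2 ≤ G.edist v x

theorem exists_adj_edist_add_one_eq {G : SimpleGraph V} {v x : V} (h : G.edist v x ≠ ⊤)
    (hne : v ≠ x) : ∃ y, G.Adj y x ∧ G.edist v y + 1 = G.edist v x := by
  obtain ⟨w, hw⟩ := G.exists_walk_of_edist_ne_top h
  have hnil : ¬ w.Nil := SimpleGraph.Walk.not_nil_of_ne hne
  refine ⟨w.penultimate, w.adj_penultimate hnil, le_antisymm ?_ ?_⟩
  · rw [← hw]
    have h1 := edist_le w.dropLast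
    have h2 : w.dropLast.length + 1 = w.length := by
      rw [SimpleGraph.Walk.length_dropLast_add_one hnil]
    calc G.edist v w.penultimate + 1 ≤ (w.dropLast.length : ℕ∞) + 1 := by gcongr
      _ = w.length := by exact_mod_cast h2
  · refine (G.edist_triangle (v := w.penultimate)).trans ?_
    rw [edist_eq_one_iff_adj.2 (w.adj_penultimate hnil)]

/-- Along the last edge of a shortest path from `v` the distance from `v` grows by one, and that
from `u` by at most one. -/
theorem CloserByTwo.of_adj {G : SimpleGraph V} {u v x y : V} (h : CloserByTwo G u v y)
    (hxy : G.Adj y x) (hd : G.edist v y + 1 = G.edist v x) : CloserByTwo G u v x := by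
  unfold CloserByTwo at *
  rw [← hd]
  calc G.edist u x + 2 ≤ (G.edist u y + G.edist y x) + 2 := by
        gcongr; exact G.edist_triangle
    _ = (G.edist u y + 2) + 1 := by rw [edist_eq_one_iff_adj.2 hxy]; ring
    _ ≤ _ := by gcongr

open scoped Classical in
/-- The vertices of `R` with a neighbour in `X`. -/
noncomputable def neighborsIn (G : SimpleGraph V) (X R : Finset V) : Finset V :=
  R.filter fun w => ∃ x ∈ X, G.Adj x w

theorem mem_neighborsIn {G : SimpleGraph V} {X R : Finset V} {w : V} :
    w ∈ neighborsIn G X R ↔ w ∈ R ∧ ∃ x ∈ X, G.Adj x w := by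
  simp [neighborsIn]

open scoped Classical in
/-- Simultaneous breadth-first search from `A` and `B` inside `R`: in each round first the
layer `B` is replaced by its unexplored neighbours, then the layer `A`. The result is the layer
reached from `A`. -/
noncomputable def explore (G : SimpleGraph V) : ℕ → Finset V → Finset V → Finset V → Finset V
  | 0, A, _, _ => A
  | j + 1, A, B, R =>
    explore G j (neighborsIn G A (R \ neighborsIn G B R)) (neighborsIn G B R)
      ((R \ neighborsIn G B R) \ neighborsIn G A (R \ neighborsIn G B R))

/-- The invariant of the search when the layer `A` is at distance at most `l` from `u` and
the layer `B` is at distance at most `l + 1` from `v`. -/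
structure ExploreInvariant (G : SimpleGraph V) (u v : V) (l : ℕ) (A B R : Finset V) : Prop where
  closer : ∀ x ∈ A, CloserByTwo G u v x
  edist_le_left : ∀ x ∈ A, G.edist u x ≤ l
  edist_le_right : ∀ x ∈ B, G.edist v x ≤ l + 1
  adj : ∀ x ∈ R, ∀ y, G.Adj y x → y ∈ B ∨ CloserByTwo G u v y ∨ (l + 2 : ℕ∞) ≤ G.edist v y
  explored : ∀ y, y ∉ R → CloserByTwo G u v y ∨ G.edist v y ≤ l + 1
  notMem : v ∉ R

/-- Let `y` precede `x` on a shortest path from `v`. It is not in `B`, since `x` was not claimed; so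
either `y` is closer to `u` by two, which passes on to `x`, or `y` is at distance at least `l + 2`
from `v`. -/
theorem ExploreInvariant.closer_or_le {G : SimpleGraph V} {u v : V} {l : ℕ} {A B R : Finset V}
    (h : ExploreInvariant G u v l A B R) {x : V} (hx : x ∈ R) (hB : x ∉ neighborsIn G B R) :
    CloserByTwo G u v x ∨ (l + 3 : ℕ∞) ≤ G.edist v x := by
  by_cases htop : G.edist v x = ⊤
  · right; rw [htop]; exact le_top
  obtain ⟨y, hyx, hd⟩ := exists_adj_edist_add_one_eq htop (by rintro rfl; exact h.notMem hx)
  rcases h.adj x hx y hyx with hy | hy | hy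
  · exact absurd (mem_neighborsIn.2 ⟨hx, y, hy, hyx⟩) hB
  · exact Or.inl (hy.of_adj hyx hd)
  · right
    rw [← hd]
    calc (l + 3 : ℕ∞) = l + 2 + 1 := by ring
      _ ≤ _ := by gcongr

theorem edist_le_of_mem_neighborsIn {G : SimpleGraph V} {v x : V} {l : ℕ} {X R : Finset V}
    (hX : ∀ y ∈ X, G.edist v y ≤ l) (hx : x ∈ neighborsIn G X R) :
    G.edist v x ≤ (l + 1 : ℕ) := by
  obtain ⟨-, y, hy, hyx⟩ := mem_neighborsIn.1 hx
  refine (G.edist_triangle (v := y)).trans ?_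
  rw [edist_eq_one_iff_adj.2 hyx]
  push_cast
  exact add_le_add_left (hX y hy) 1

open scoped Classical in
-- A vertex newly reached from `A` is within `l + 1` of `u`, and by `closer_or_le` it is at least `l
-- + 3` from `v` unless it is already known to be closer to `u` by two.
theorem ExploreInvariant.step {G : SimpleGraph V} {u v : V} {l : ℕ} {A B R : Finset V}
    (h : ExploreInvariant G u v l A B R) :
    ExploreInvariant G u v (l + 1) (neighborsIn G A (R \ neighborsIn G B R)) (neighborsIn G B R)
      ((R \ neighborsIn G B R) \ neighborsIn G A (R \ neighborsIn G B R)) := by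
  have hA : ∀ x ∈ neighborsIn G A (R \ neighborsIn G B R), G.edist u x ≤ (l + 1 : ℕ) :=
    fun x hx => edist_le_of_mem_neighborsIn h.edist_le_left hx
  have hB : ∀ x ∈ neighborsIn G B R, G.edist v x ≤ (l + 1 + 1 : ℕ) := fun x hx =>
    edist_le_of_mem_neighborsIn (l := l + 1) (fun y hy => by exact_mod_cast h.edist_le_right y hy) hx
  have hclose : ∀ x ∈ neighborsIn G A (R \ neighborsIn G B R), CloserByTwo G u v x := by
    intro x hx
    have hx' := Finset.mem_sdiff.1 (mem_neighborsIn.1 hx).1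
    rcases h.closer_or_le hx'.1 hx'.2 with hc | hc
    · exact hc
    · refine le_trans ?_ hc
      calc G.edist u x + 2 ≤ ((l + 1 : ℕ) : ℕ∞) + 2 := by gcongr; exact hA x hx
        _ = _ := by push_cast; ring
  have cast1 : ((l + 1 : ℕ) : ℕ∞) + 2 = l + 3 := by push_cast; ring
  refine ⟨hclose, hA, fun x hx => by exact_mod_cast hB x hx, ?_, ?_, ?_⟩
  · intro x hx y hyx
    have hx1 := Finset.mem_sdiff.1 (Finset.mem_sdiff.1 hx).1
    rw [cast1]
    by_cases hyR : y ∈ R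
    · by_cases hyB : y ∈ neighborsIn G B R
      · exact Or.inl hyB
      · exact Or.inr (h.closer_or_le hyR hyB)
    · rcases h.adj x hx1.1 y hyx with hy | hy | hy
      · exact absurd (mem_neighborsIn.2 ⟨hx1.1, y, hy, hyx⟩) hx1.2
      · exact Or.inr (Or.inl hy)
      -- An explored vertex that is not closer to `u` by two lies within `l + 1` of `v`, which
      -- contradicts the lower bound `l + 2`.
      · rcases h.explored y hyR with hy' | hy'
        · exact Or.inr (Or.inl hy')
        · exfalso
          have := hy.trans hy'
          have h' : l + 2 ≤ l + 1 := by exact_mod_cast this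
          omega
  · intro y hy
    by_cases hyR : y ∈ R
    · by_cases hyB : y ∈ neighborsIn G B R
      · right; exact_mod_cast hB y hyB
      · left
        refine hclose y ?_
        by_contra hyA
        exact hy (Finset.mem_sdiff.2 ⟨Finset.mem_sdiff.2 ⟨hyR, hyB⟩, hyA⟩)
    · refine (h.explored y hyR).imp_right fun h' => h'.trans ?_
      push_cast
      gcongr
      exact le_self_add
  · exact fun hv => h.notMem (Finset.mem_sdiff.1 (Finset.mem_sdiff.1 hv).1).1

/-- Finiteness is recorded because `CloserByTwo` also holds when both distances are `⊤`, and such a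
vertex distinguishes nothing. -/
theorem ExploreInvariant.mem_explore {G : SimpleGraph V} {u v : V} (j : ℕ) :
    ∀ {l : ℕ} {A B R : Finset V}, ExploreInvariant G u v l A B R →
      ∀ x ∈ explore G j A B R, CloserByTwo G u v x ∧ G.edist u x ≠ ⊤ := by
  induction j with
  | zero =>
    intro l A B R h x hx
    exact ⟨h.closer x hx, ne_top_of_le_ne_top (ENat.natCast_ne_top l) (h.edist_le_left x hx)⟩
  | succ j ih =>
    intro l A B R h x hx
    exact ih h.step x hx

open scoped Classical in
-- The search from `v` has already taken its first step. Non-adjacency puts `u` itself at distance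
-- at least two from `v`.
theorem exploreInvariant_init {G : SimpleGraph V} {u v : V} [Fintype V] (hne : u ≠ v)
    (hadj : ¬ G.Adj u v) :
    ExploreInvariant G u v 0 {u} (neighborsIn G {v} (Finset.univ \ {u, v}))
      ((Finset.univ \ {u, v}) \ neighborsIn G {v} (Finset.univ \ {u, v})) := by
  have htwo : ∀ x, x ≠ v → ¬ G.Adj v x → (2 : ℕ∞) ≤ G.edist v x := by
    intro x hx hvx
    by_contra hlt
    have : G.edist v x ≤ 1 := by simpa using lt_of_not_ge hlt
    rcases edist_le_one_iff_adj_or_eq.1 this with h | h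
    · exact hvx h
    · exact hx h.symm
  have hu : CloserByTwo G u v u := by
    unfold CloserByTwo
    simpa using htwo u hne fun h => hadj h.symm
  have hmem : ∀ x, x ∈ neighborsIn G {v} (Finset.univ \ {u, v}) ↔ G.Adj v x := by
    intro x
    simp only [mem_neighborsIn, Finset.mem_sdiff, Finset.mem_univ, true_and, Finset.mem_insert,
      Finset.mem_singleton, exists_eq_left, and_iff_right_iff_imp]
    rintro h (rfl | rfl)
    · exact hadj h.symm
    · exact G.loopless.irrefl _ h
  refine ⟨by simpa using hu, by simp, ?_, ?_, ?_, by simp⟩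
  · intro x hx
    rw [edist_eq_one_iff_adj.2 ((hmem x).1 hx)]; simp
  · intro x hx y hyx
    have hx1 : ¬ G.Adj v x := fun h => (Finset.mem_sdiff.1 hx).2 ((hmem x).2 h)
    by_cases hy : G.Adj v y
    · exact Or.inl ((hmem y).2 hy)
    · right; right
      simpa using htwo y (by rintro rfl; exact hx1 hyx) hy
  · intro y hy
    by_cases h1 : y = u
    · subst h1; exact Or.inl hu
    · right
      by_cases h2 : y = v
      · subst h2; simp
      · have : G.Adj v y := by
          by_contra h3
          exact hy (by simp [h1, h2, hmem, h3])
        rw [edist_eq_one_iff_adj.2 this]; simp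

open scoped Classical in
theorem explore_congr {G H : SimpleGraph V} (j : ℕ) : ∀ {A B R : Finset V},
    (∀ x ∈ A ∪ B ∪ R, ∀ y ∈ R, G.Adj x y ↔ H.Adj x y) → explore G j A B R = explore H j A B R := by
  induction j with
  | zero => intros; rfl
  | succ j ih =>
    intro A B R h
    have hB : neighborsIn G B R = neighborsIn H B R := by
      ext w
      simp only [mem_neighborsIn]
      refine and_congr_right fun hw => exists_congr fun x => and_congr_right fun hx => ?_
      exact h x (by simp [hx]) w hw
    have hA : neighborsIn G A (R \ neighborsIn H B R) = neighborsIn H A (R \ neighborsIn H B R) := by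
      ext w
      simp only [mem_neighborsIn]
      refine and_congr_right fun hw => exists_congr fun x => and_congr_right fun hx => ?_
      exact h x (by simp [hx]) w (Finset.mem_sdiff.1 hw).1
    rw [explore, explore, hB, hA]
    refine ih fun x hx y hy => ?_
    refine h x ?_ y (Finset.mem_sdiff.1 (Finset.mem_sdiff.1 hy).1).1
    simp only [Finset.mem_union, mem_neighborsIn, Finset.mem_sdiff] at hx ⊢
    tauto

end Exploration

/-! ### Layer sizes in one round of the search. -/

section LayerSizes

open MeasureTheory ProbabilityTheory SimpleGraph unitInterval

variable {V : Type*}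

theorem eventDependsOn_exists_adj (X : Finset V) (w : V) :
    EventDependsOn {e | ∃ x ∈ X, e = s(x, w)} {G : SimpleGraph V | ∃ x ∈ X, G.Adj x w} := by
  rintro G H h ⟨x, hx, hadj⟩
  exact ⟨x, hx, (h s(x, w) ⟨x, hx, rfl⟩).1 hadj⟩

theorem eventDependsOn_mem_neighborsIn (X R : Finset V) (w : V) :
    EventDependsOn {e | w ∈ R ∧ ∃ x ∈ X, e = s(x, w)}
      {G : SimpleGraph V | w ∈ neighborsIn G X R} := by
  intro G H h hG
  rw [Set.mem_ofPred_eq, mem_neighborsIn] at hG ⊢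
  obtain ⟨hw, x, hx, hadj⟩ := hG
  exact ⟨hw, x, hx, (h s(x, w) ⟨hw, x, hx, rfl⟩).1 hadj⟩

open scoped Classical in
-- Whether `w` joins the new `A`-layer is decided by the edges from `A ∪ B` to `w` alone. For
-- distinct `w` in `R` these edge sets are disjoint, hence the independence needed for Chernoff.
theorem eventDependsOn_mem_neighborsIn_sdiff (A B R : Finset V) (w : V) :
    EventDependsOn {e | w ∈ R ∧ ∃ x ∈ A ∪ B, e = s(x, w)}
      {G : SimpleGraph V | w ∈ neighborsIn G A (R \ neighborsIn G B R)} := by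
  have h1 := (eventDependsOn_mem_neighborsIn A R w).mono
    (F' := {e | w ∈ R ∧ ∃ x ∈ A ∪ B, e = s(x, w)})
    fun e ⟨hw, x, hx, he⟩ => ⟨hw, x, by simp [hx], he⟩
  have h2 := (eventDependsOn_mem_neighborsIn B R w).mono
    (F' := {e | w ∈ R ∧ ∃ x ∈ A ∪ B, e = s(x, w)})
    fun e ⟨hw, x, hx, he⟩ => ⟨hw, x, by simp [hx], he⟩
  convert h1.inter h2.compl using 1
  ext G
  simp only [Set.mem_ofPred_eq, Set.mem_inter_iff, Set.mem_compl_iff, mem_neighborsIn,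
    Finset.mem_sdiff]
  tauto

theorem pairwise_disjoint_edges_to {X R : Finset V} (h : Disjoint X R) :
    Pairwise (Function.onFun Disjoint fun w : V => {e | w ∈ R ∧ ∃ x ∈ X, e = s(x, w)}) := by
  intro w w' hne
  rw [Function.onFun, Set.disjoint_left]
  rintro e ⟨hw, x, hx, rfl⟩ ⟨hw', x', hx', he⟩
  rcases Sym2.eq_iff.1 he with ⟨-, h2⟩ | ⟨h1, -⟩
  · exact hne h2
  · exact Finset.disjoint_left.1 h hx (h1 ▸ hw')

variable [Fintype V]

theorem measureReal_exists_adj_le (p : I) {X : Finset V} {w : V} (hw : w ∉ X) :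
    (binomialRandom V p).real {G | ∃ x ∈ X, G.Adj x w} ≤ (p : ℝ) * X.card := by
  have : {G : SimpleGraph V | ∃ x ∈ X, G.Adj x w} = ⋃ x ∈ X, {G | G.Adj x w} := by
    ext G; simp
  rw [this]
  refine (measureReal_biUnion_finset_le _ _).trans ?_
  rw [Finset.sum_congr rfl fun x hx => binomialRandom_adj (p := p)
    (show x ≠ w by rintro rfl; exact hw hx)]
  simp [mul_comm]

theorem measureReal_not_exists_adj (p : I) {X : Finset V} {w : V} (hw : w ∉ X) :
    (binomialRandom V p).real {G | ∃ x ∈ X, G.Adj x w}ᶜ = (1 - p) ^ X.card := by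
  classical
  induction X using Finset.induction_on with
  | empty => simp
  | insert x X hx ih =>
    have hxw : x ≠ w := by rintro rfl; simp at hw
    have hset : {G : SimpleGraph V | ∃ y ∈ insert x X, G.Adj y w}ᶜ =
        {G | G.Adj x w}ᶜ ∩ {G | ∃ y ∈ X, G.Adj y w}ᶜ := by
      ext G; simp
    rw [hset, measureReal_def, binomialRandom_inter (F := {s(x, w)})
      (F' := {e | ∃ y ∈ X, e = s(y, w)}) ?_ (eventDependsOn_adj x w).compl
      (eventDependsOn_exists_adj X w).compl, ENNReal.toReal_mul, ← measureReal_def,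
      ← measureReal_def, ih (by simp at hw; tauto), measureReal_compl .of_discrete,
      binomialRandom_adj hxw, Finset.card_insert_of_notMem hx]
    · simp [pow_succ, mul_comm]
    · rw [Set.disjoint_left]
      rintro e rfl ⟨y, hy, he⟩
      rcases Sym2.eq_iff.1 he with ⟨h, -⟩ | ⟨h, -⟩
      · exact hx (h ▸ hy)
      · exact hxw h

theorem le_measureReal_adj_not_adj (p : I) {A B : Finset V} {w : V} (hA : w ∉ A) (hB : w ∉ B)
    (hAB : Disjoint A B) (h1 : (p : ℝ) * A.card ≤ 1) :
    (p : ℝ) * A.card * (1 - p * A.card - p * B.card) ≤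
      (binomialRandom V p).real ({G | ∃ x ∈ A, G.Adj x w} ∩ {G | ∃ x ∈ B, G.Adj x w}ᶜ) := by
  have hp0 : (0 : ℝ) ≤ p := p.2.1
  have hp1 : (p : ℝ) ≤ 1 := p.2.2
  rw [measureReal_def, binomialRandom_inter (F := {e | ∃ y ∈ A, e = s(y, w)})
      (F' := {e | ∃ y ∈ B, e = s(y, w)}) ?_ (eventDependsOn_exists_adj A w)
      (eventDependsOn_exists_adj B w).compl, ENNReal.toReal_mul, ← measureReal_def,
      ← measureReal_def, measureReal_not_exists_adj p hB]
  · have hA' := measureReal_not_exists_adj p hA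
    rw [measureReal_compl .of_discrete] at hA'
    simp only [probReal_univ] at hA'
    set x : ℝ := p * A.card with hx
    have hx0 : 0 ≤ x := by positivity
    have hpow : (1 - (p : ℝ)) ^ A.card ≤ 1 - x + x ^ 2 := by
      calc (1 - (p : ℝ)) ^ A.card ≤ Real.exp (-p) ^ A.card := by
            refine pow_le_pow_left₀ (by linarith) ?_ _
            linarith [Real.add_one_le_exp (-(p : ℝ))]
        _ = Real.exp (-x) := by rw [← Real.exp_nat_mul, hx]; ring_nf
        _ ≤ 1 - x + x ^ 2 := by
            have := abs_le.1 (Real.abs_exp_sub_one_sub_id_le (x := -x)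
              (by rw [abs_neg, abs_of_nonneg hx0]; exact h1))
            nlinarith [this.2]
    have hB' : 1 - (p : ℝ) * B.card ≤ (1 - (p : ℝ)) ^ B.card := by
      have := one_add_mul_le_pow (a := -(p : ℝ)) (by linarith) B.card
      calc _ = 1 + (B.card : ℝ) * -(p : ℝ) := by ring
        _ ≤ _ := by simpa [sub_eq_add_neg] using this
    have hy0 : 0 ≤ (p : ℝ) * B.card := by positivity
    have hpb : 0 ≤ (1 - (p : ℝ)) ^ B.card := pow_nonneg (by linarith) _
    have hE : x - x ^ 2 ≤ (binomialRandom V p).real {G | ∃ x ∈ A, G.Adj x w} := by linarith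
    calc x * (1 - x - p * B.card) ≤ (x - x ^ 2) * (1 - p * B.card) := by
          nlinarith [mul_nonneg (mul_nonneg hx0 hx0) hy0]
      _ ≤ (x - x ^ 2) * (1 - (p : ℝ)) ^ B.card := by
          refine mul_le_mul_of_nonneg_left hB' ?_
          nlinarith
      _ ≤ _ := mul_le_mul_of_nonneg_right hE hpb
  · rw [Set.disjoint_left]
    rintro e ⟨x, hx, rfl⟩ ⟨y, hy, he⟩
    rcases Sym2.eq_iff.1 he with ⟨h, -⟩ | ⟨h, -⟩
    · exact Finset.disjoint_left.1 hAB hx (h ▸ hy)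
    · exact hA (h ▸ hx)

theorem measureReal_card_neighborsIn_ge_le (p : I) {X R : Finset V} (h : Disjoint X R) {m ε : ℝ}
    (hm : (p : ℝ) * X.card * R.card ≤ m) (hε : 0 ≤ ε) (hε1 : ε ≤ 1) :
    (binomialRandom V p).real {G | (1 + ε) * m ≤ (neighborsIn G X R).card} ≤
      Real.exp (-(ε ^ 2 * m / 4)) := by
  classical
  have hind := binomialRandom_iIndepSet (p := p) (pairwise_disjoint_edges_to h)
    (fun w => eventDependsOn_mem_neighborsIn X R w)
  have := measureReal_card_ge_le (fun w => .of_discrete) hind (R := R) (q := (p : ℝ) * X.card)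
    (fun w hw => ?_) hm hε hε1
  · refine le_trans (le_of_eq ?_) this
    congr 1
    ext G
    have : R.filter (fun w => w ∈ neighborsIn G X R) = neighborsIn G X R := by
      ext w; simp only [Finset.mem_filter, mem_neighborsIn]; tauto
    simp only [Set.mem_ofPred_eq]
    rw [← this]
    convert Iff.rfl
  · refine le_trans (measureReal_mono ?_) (measureReal_exists_adj_le p
      (Finset.disjoint_right.1 h hw))
    exact fun G hG => (mem_neighborsIn.1 hG).2

open scoped Classical in
theorem measureReal_card_neighborsIn_sdiff_le_le (p : I) {A B R : Finset V} (hAB : Disjoint A B)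
    (h : Disjoint (A ∪ B) R) {m ε : ℝ} (h1 : (p : ℝ) * A.card ≤ 1)
    (hm : m ≤ (p : ℝ) * A.card * (1 - p * A.card - p * B.card) * R.card) (hm0 : 0 ≤ m)
    (hε : 0 ≤ ε) (hε1 : ε ≤ 1) :
    (binomialRandom V p).real
        {G | ((neighborsIn G A (R \ neighborsIn G B R)).card : ℝ) ≤ (1 - ε) * m} ≤
      Real.exp (-(ε ^ 2 * m / 4)) := by
  have hind := binomialRandom_iIndepSet (p := p) (pairwise_disjoint_edges_to h)
    (fun w => eventDependsOn_mem_neighborsIn_sdiff A B R w)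
  have := measureReal_card_le_le (fun w => .of_discrete) hind (R := R)
    (q := (p : ℝ) * A.card * (1 - p * A.card - p * B.card))
    (fun w hw => ?_) hm hm0 hε hε1
  · refine le_trans (le_of_eq ?_) this
    congr 1
    ext G
    have : R.filter (fun w => w ∈ neighborsIn G A (R \ neighborsIn G B R)) =
        neighborsIn G A (R \ neighborsIn G B R) := by
      ext w; simp only [Finset.mem_filter, mem_neighborsIn, Finset.mem_sdiff]; tauto
    simp only [Set.mem_ofPred_eq]
    rw [← this]
    convert Iff.rfl
  · have hw' := Finset.disjoint_right.1 h hw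
    simp only [Finset.mem_union, not_or] at hw'
    refine (le_measureReal_adj_not_adj p hw'.1 hw'.2 hAB h1).trans (measureReal_mono ?_)
    rintro G ⟨hG1, hG2⟩
    simp only [Set.mem_ofPred_eq, Set.mem_compl_iff, mem_neighborsIn, Finset.mem_sdiff] at hG1 hG2 ⊢
    exact ⟨⟨hw, fun h => hG2 h.2⟩, hG1⟩

/-- The sizes of the layers and of the unexplored part after `l` rounds of the search, when the
average degree is `d`. -/
structure LayerSizes (d : ℝ) (l : ℕ) (A B R : Finset V) : Prop where
  le_left : (1 - (1 - (1 / 2) ^ l) / 4 - 4 * d ^ (l + 1) / Fintype.card V) * d ^ l ≤ A.card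
  left_le : A.card ≤ (2 - (1 / 2) ^ l / 2) * d ^ l
  right_le : B.card ≤ (2 - (1 / 2) ^ l / 2) * d ^ (l + 1)
  le_rest : (Fintype.card V : ℝ) - 8 * d ^ (l + 1) ≤ R.card


/-- The relative error `(1 / 2) ^ l / 8` may shrink geometrically because layers grow faster than
its square decays: `(d / 4) ^ l ≥ 1`. -/
theorem exp_neg_le_exp_neg_div {d : ℝ} (hd : 16 ≤ d) (l : ℕ) {m : ℝ} (hm : d ^ (l + 1) / 2 ≤ m) :
    Real.exp (-(((1 / 2) ^ l / 8) ^ 2 * m / 4)) ≤ Real.exp (-(d / 512)) := by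
  rw [Real.exp_le_exp, neg_le_neg_iff]
  have h1 : (1 : ℝ) ≤ ((1 / 2) ^ l) ^ 2 * d ^ l := by
    rw [← pow_mul, mul_comm l 2, pow_mul, ← mul_pow]
    exact one_le_pow₀ (by linarith)
  calc d / 512 ≤ d / 512 * (((1 / 2) ^ l) ^ 2 * d ^ l) := le_mul_of_one_le_right (by linarith) h1
    _ = ((1 / 2) ^ l / 8) ^ 2 * (d ^ (l + 1) / 2) / 4 := by ring
    _ ≤ _ := by gcongr

/-- Used with `z = d ^ (l + 1) / n` and `y = d ^ (l + 2) / n`: depletion of `R` and collisions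
between the two layers together cost at most `3 * y`. -/
theorem sub_three_mul_le {a y z : ℝ} (ha : 0 ≤ a) (ha1 : a ≤ 1) (hz : 0 ≤ z)
    (hzy : 16 * z ≤ y) : a - 3 * y ≤ a * ((1 - 8 * z) * (1 - 2 * z - 2 * y)) := by
  have h1 : 1 - 3 * y ≤ (1 - 8 * z) * (1 - 2 * z - 2 * y) := by
    nlinarith [mul_nonneg hz hz, mul_nonneg hz (show 0 ≤ y by linarith)]
  nlinarith [mul_le_mul_of_nonneg_left h1 ha]

open scoped Classical in
-- With `e = (1 / 2) ^ l` and relative error `e / 8`, the bounds reproduce themselves: `(1 + e / 8)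
-- * (2 - e / 2) ≤ 2 - e / 4`, and the loss `e / 8` turns `(1 - e) / 4` into `(1 - e / 2) / 4`. So
-- the factors stay bounded over all rounds. Three Chernoff events can fail.
theorem measureReal_not_layerSizes_step_le (p : I) {d : ℝ} (hd : d = Fintype.card V * p)
    (hd16 : 16 ≤ d) {l : ℕ} (hl : 40 * d ^ (l + 2) ≤ Fintype.card V) {A B R : Finset V}
    (hAB : Disjoint A B) (hABR : Disjoint (A ∪ B) R) (h : LayerSizes d l A B R) :
    (binomialRandom V p).real {G | ¬ LayerSizes d (l + 1) (neighborsIn G A (R \ neighborsIn G B R))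
      (neighborsIn G B R) ((R \ neighborsIn G B R) \ neighborsIn G A (R \ neighborsIn G B R))} ≤
      3 * Real.exp (-(d / 512)) := by
  obtain ⟨h1, h2, h3, h4⟩ := h
  obtain ⟨n, hn⟩ : ∃ t : ℝ, t = (Fintype.card V : ℝ) := ⟨_, rfl⟩
  obtain ⟨e, he⟩ : ∃ t : ℝ, t = (1 / 2) ^ l := ⟨_, rfl⟩
  obtain ⟨x, hx⟩ : ∃ t : ℝ, t = d ^ l := ⟨_, rfl⟩
  rw [← hn] at h1 h4 hl hd
  rw [← he, ← hx] at h1 h2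
  rw [← he] at h3
  have hx1 : 1 ≤ x := hx ▸ one_le_pow₀ (by linarith)
  have he0 : 0 < e := by rw [he]; positivity
  have he1 : e ≤ 1 := he ▸ pow_le_one₀ (by norm_num) (by norm_num)
  have hdl1 : d ^ (l + 1) = d * x := by rw [pow_succ, hx]; ring
  have hdl2 : d ^ (l + 2) = d * (d * x) := by rw [pow_succ, hdl1]; ring
  have hp0 : (0 : ℝ) ≤ p := p.2.1
  have hdx : 16 ≤ d * x := by nlinarith
  have hddx : 16 * (d * x) ≤ d * (d * x) := mul_le_mul_of_nonneg_right hd16 (by linarith)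
  have hn0 : 0 < n := by rw [hdl2] at hl; nlinarith
  have hcancel : ∀ y, d / n * y * n = d * y := fun y => by field_simp
  have hpd : (p : ℝ) = d / n := by rw [hd]; field_simp
  clear hd
  have hRn : (R.card : ℝ) ≤ n := by rw [hn]; exact_mod_cast Finset.card_le_univ R
  rw [hdl1] at h1 h3 h4
  rw [hdl2] at hl
  obtain ⟨D, hD⟩ : ∃ t : ℝ, t = d * (d * x) / n := ⟨_, rfl⟩
  have hD0 : 0 ≤ D := by rw [hD]; positivity
  have hD40 : D ≤ 1 / 40 := by rw [hD, div_le_iff₀ hn0]; linarith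
  obtain ⟨D', hD'⟩ : ∃ t : ℝ, t = d * x / n := ⟨_, rfl⟩
  have hDD : d * D' = D := by rw [hD, hD']; ring
  have hD'0 : 0 ≤ D' := by rw [hD']; positivity
  have hD'D : 16 * D' ≤ D := by nlinarith
  obtain ⟨α, hα⟩ : ∃ t : ℝ, t = 1 - (1 - e) / 4 - 4 * D' := ⟨_, rfl⟩
  have hα' : 1 - (1 - e) / 4 - 4 * (d * x) / n = α := by rw [hα, hD']; ring
  rw [hα'] at h1
  have hα0 : 0.7 ≤ α := by rw [hα]; linarith
  have hα0' : 0 ≤ α := by linarith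
  have hα1 : α ≤ 1 := by rw [hα]; linarith
  obtain ⟨β, hβ⟩ : ∃ t : ℝ, t = 2 - e / 2 := ⟨_, rfl⟩
  rw [← hβ] at h2 h3
  have hβ1 : 1 ≤ β := by rw [hβ]; linarith
  have ha0 : (0 : ℝ) ≤ A.card := Nat.cast_nonneg _
  have hb0 : (0 : ℝ) ≤ B.card := Nat.cast_nonneg _
  have hr0 : (0 : ℝ) ≤ R.card := Nat.cast_nonneg _
  have hpa : (p : ℝ) * A.card ≤ 2 * D' := by
    calc (p : ℝ) * A.card ≤ d / n * (2 * x) := by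
          rw [hpd]; gcongr; exact h2.trans (by gcongr; linarith)
      _ = 2 * D' := by rw [hD']; ring
  have hpb : (p : ℝ) * B.card ≤ 2 * D := by
    calc (p : ℝ) * B.card ≤ d / n * (2 * (d * x)) := by
          rw [hpd]; gcongr; exact h3.trans (by gcongr; linarith)
      _ = 2 * D := by rw [hD]; ring
  have hpr : d * (1 - 8 * D') ≤ p * R.card := by
    calc d * (1 - 8 * D') = d / n * (n - 8 * (d * x)) := by rw [hD']; field_simp
      _ ≤ p * R.card := by rw [hpd]; gcongr
  obtain ⟨mB, hmB⟩ : ∃ t : ℝ, t = β * (d * (d * x)) := ⟨_, rfl⟩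
  obtain ⟨mA, hmA⟩ : ∃ t : ℝ, t = β * (d * x) := ⟨_, rfl⟩
  obtain ⟨mL, hmL⟩ : ∃ t : ℝ, t = (α - 3 * D) * (d * x) := ⟨_, rfl⟩
  have hB := measureReal_card_neighborsIn_ge_le p (X := B) (R := R) (m := mB) (ε := e / 8)
    (Finset.disjoint_of_subset_left Finset.subset_union_right hABR) ?_ (by positivity) (by linarith)
  rotate_left
  · calc (p : ℝ) * B.card * R.card ≤ d / n * (β * (d * x)) * n := by rw [hpd]; gcongr
      _ = mB := by rw [hcancel, hmB]; ring
  have hA := measureReal_card_neighborsIn_ge_le p (X := A) (R := R) (m := mA) (ε := e / 8)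
    (Finset.disjoint_of_subset_left Finset.subset_union_left hABR) ?_ (by positivity) (by linarith)
  rotate_left
  · calc (p : ℝ) * A.card * R.card ≤ d / n * (β * x) * n := by rw [hpd]; gcongr
      _ = mA := by rw [hcancel, hmA]; ring
  have hL := measureReal_card_neighborsIn_sdiff_le_le p hAB hABR (m := mL) (ε := e / 8)
    (by linarith) ?_ ?_ (by positivity) (by linarith)
  rotate_left
  · have hq : 1 - 2 * D' - 2 * D ≤ 1 - p * A.card - p * B.card := by linarith
    calc mL ≤ α * x * (d * (1 - 8 * D')) * (1 - 2 * D' - 2 * D) := by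
          rw [hmL]
          have := sub_three_mul_le hα0' hα1 hD'0 hD'D
          calc (α - 3 * D) * (d * x) ≤ α * ((1 - 8 * D') * (1 - 2 * D' - 2 * D)) * (d * x) := by
                gcongr
            _ = _ := by ring
      _ ≤ A.card * (p * R.card) * (1 - p * A.card - p * B.card) := by
          have : 0 ≤ 1 - 8 * D' := by linarith
          have : 0 ≤ 1 - 2 * D' - 2 * D := by linarith
          gcongr
      _ = _ := by ring
  · rw [hmL]
    have : 0 ≤ α - 3 * D := by linarith
    positivity
  have hsub : {G : SimpleGraph V | ¬ LayerSizes d (l + 1)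
      (neighborsIn G A (R \ neighborsIn G B R)) (neighborsIn G B R)
      ((R \ neighborsIn G B R) \ neighborsIn G A (R \ neighborsIn G B R))} ⊆
      {G | (1 + e / 8) * mB ≤ (neighborsIn G B R).card} ∪
      {G | (1 + e / 8) * mA ≤ (neighborsIn G A R).card} ∪
      {G | ((neighborsIn G A (R \ neighborsIn G B R)).card : ℝ) ≤ (1 - e / 8) * mL} := by
    intro G hG
    by_contra hcon
    simp only [Set.mem_union, Set.mem_ofPred_eq, not_or, not_le] at hcon
    obtain ⟨⟨c1, c2⟩, c3⟩ := hcon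
    apply hG
    have hsubs : neighborsIn G A (R \ neighborsIn G B R) ⊆ neighborsIn G A R := by
      intro w hw
      rw [mem_neighborsIn] at hw ⊢
      exact ⟨(Finset.mem_sdiff.1 hw.1).1, hw.2⟩
    have hle : ((neighborsIn G A (R \ neighborsIn G B R)).card : ℝ) ≤ (neighborsIn G A R).card := by
      exact_mod_cast Finset.card_le_card hsubs
    have hβ' : (1 + e / 8) * β ≤ 2 - (1 / 2) ^ (l + 1) / 2 := by
      have : ((1 : ℝ) / 2) ^ (l + 1) = e / 2 := by rw [pow_succ, he]; ring
      rw [this, hβ]; linarith [mul_pos he0 he0]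
    have hβ2 : 2 - ((1 : ℝ) / 2) ^ (l + 1) / 2 ≤ 2 := by
      have : (0 : ℝ) ≤ (1 / 2) ^ (l + 1) := by positivity
      linarith
    have hbB : ((neighborsIn G B R).card : ℝ) ≤ (2 - (1 / 2) ^ (l + 1) / 2) * (d * (d * x)) := by
      refine c1.le.trans ?_
      rw [hmB, ← mul_assoc]; gcongr
    have hbA : ((neighborsIn G A (R \ neighborsIn G B R)).card : ℝ) ≤
        (2 - (1 / 2) ^ (l + 1) / 2) * (d * x) := by
      refine hle.trans (c2.le.trans ?_)
      rw [hmA, ← mul_assoc]; gcongr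
    refine ⟨?_, by rw [hdl1]; exact hbA, by rw [show l + 1 + 1 = l + 2 from rfl, hdl2]; exact hbB, ?_⟩
    · refine le_trans ?_ c3.le
      rw [hdl1, show l + 1 + 1 = l + 2 from rfl, hdl2, hmL,
        show (1 - e / 8) * ((α - 3 * D) * (d * x)) = ((1 - e / 8) * (α - 3 * D)) * (d * x) by ring]
      refine mul_le_mul_of_nonneg_right ?_ (by linarith)
      have h6 : ((1 : ℝ) / 2) ^ (l + 1) = e / 2 := by rw [pow_succ, he]; ring
      have h7 : 4 * (d * (d * x)) / (Fintype.card V : ℝ) = 4 * D := by rw [hD, ← hn]; ring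
      have h8 : e * (α - 3 * D) ≤ e * 1 := mul_le_mul_of_nonneg_left (by linarith) he0.le
      rw [h6, h7]
      linarith
    · have hcard : ((R.card : ℕ) : ℝ) ≤ ((R \ neighborsIn G B R) \
          neighborsIn G A (R \ neighborsIn G B R)).card + (neighborsIn G B R).card +
          (neighborsIn G A (R \ neighborsIn G B R)).card := by
        have i1 := Finset.card_le_card_sdiff_add_card (t := neighborsIn G B R) (s := R)
        have i2 := Finset.card_le_card_sdiff_add_card
          (t := neighborsIn G A (R \ neighborsIn G B R)) (s := R \ neighborsIn G B R)
        have : R.card ≤ ((R \ neighborsIn G B R) \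
          neighborsIn G A (R \ neighborsIn G B R)).card + (neighborsIn G B R).card +
          (neighborsIn G A (R \ neighborsIn G B R)).card := by omega
        exact_mod_cast this
      rw [show l + 1 + 1 = l + 2 from rfl, hdl2]
      have j1 := hbB.trans (mul_le_mul_of_nonneg_right hβ2 (by positivity))
      have j2 := hbA.trans (mul_le_mul_of_nonneg_right hβ2 (by positivity))
      rw [← hn]
      linarith
  refine (measureReal_mono hsub).trans ((measureReal_union_le _ _).trans ?_)
  have hu := measureReal_union_le (μ := binomialRandom V p)
    {G : SimpleGraph V | (1 + e / 8) * mB ≤ (neighborsIn G B R).card}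
    {G | (1 + e / 8) * mA ≤ (neighborsIn G A R).card}
  have k1 := exp_neg_le_exp_neg_div hd16 l (m := mB) (by
    rw [hdl1, hmB]
    linarith [le_mul_of_one_le_left (show 0 ≤ d * (d * x) by linarith) hβ1])
  have k2 := exp_neg_le_exp_neg_div hd16 l (m := mA) (by
    rw [hdl1, hmA]
    linarith [le_mul_of_one_le_left (show 0 ≤ d * x by linarith) hβ1])
  have k3 := exp_neg_le_exp_neg_div hd16 l (m := mL) (by
    rw [hdl1, hmL]
    linarith [mul_le_mul_of_nonneg_right (show 1 / 2 ≤ α - 3 * D by linarith)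
      (show 0 ≤ d * x by linarith)])
  rw [← he] at k1 k2 k3
  linarith

end LayerSizes

/-! ### Many vertices distinguish a non-adjacent pair. -/

section Landmarks

open MeasureTheory ProbabilityTheory SimpleGraph unitInterval

variable {V : Type*}

theorem neighborsIn_congr {G H : SimpleGraph V} {X R : Finset V}
    (h : ∀ x ∈ X, ∀ w ∈ R, G.Adj x w ↔ H.Adj x w) : neighborsIn G X R = neighborsIn H X R := by
  ext w
  simp only [mem_neighborsIn]
  exact and_congr_right fun hw => exists_congr fun x => and_congr_right fun hx => h x hx w hw

open scoped Classical in
theorem eventDependsOn_explore (j : ℕ) {A B R S : Finset V} (hA : A ⊆ S) (hB : B ⊆ S) (hR : R ⊆ S)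
    (P : Finset V → Prop) :
    EventDependsOn {e | ∃ x ∈ S, ∃ y ∈ S, e = s(x, y)} {G : SimpleGraph V | P (explore G j A B R)} := by
  intro G H h hG
  have : explore G j A B R = explore H j A B R := by
    refine explore_congr j fun x hx y hy => ?_
    have hx' : x ∈ S := Finset.union_subset (Finset.union_subset hA hB) hR hx
    simpa using h s(x, y) ⟨x, hx', y, hR hy, rfl⟩
  rw [Set.mem_ofPred_eq] at hG ⊢
  rwa [← this]

variable [Fintype V]

theorem LayerSizes.half_le {d : ℝ} (hd16 : 16 ≤ d) {l : ℕ} {A B R : Finset V}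
    (hl : 40 * d ^ (l + 1) ≤ Fintype.card V) (h : LayerSizes d l A B R) : d ^ l / 2 ≤ A.card := by
  refine le_trans ?_ h.le_left
  have hdl : 0 < d ^ (l + 1) := by positivity
  have hn : (0 : ℝ) < Fintype.card V := by linarith
  have h1 : 4 * d ^ (l + 1) / Fintype.card V ≤ 1 / 10 := by
    rw [div_le_iff₀ hn]; linarith
  have h2 : (0 : ℝ) ≤ (1 / 2) ^ l := by positivity
  rw [div_eq_inv_mul]
  refine mul_le_mul_of_nonneg_right ?_ (by positivity)
  linarith

open scoped Classical in
-- A round exposes only edges between `A ∪ B` and `R`, whereas the later rounds use only edges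
-- inside `R`; hence `binomialRandom_bind_le` applies in every round.
theorem measureReal_card_explore_lt_le (p : I) {d : ℝ} (hd : d = Fintype.card V * p)
    (hd16 : 16 ≤ d) (j : ℕ) : ∀ {l : ℕ} {A B R : Finset V},
    40 * d ^ (l + j + 1) ≤ Fintype.card V → Disjoint A B → Disjoint (A ∪ B) R →
    LayerSizes d l A B R →
    (binomialRandom V p).real {G | ((explore G j A B R).card : ℝ) < d ^ (l + j) / 2} ≤
      j * (3 * Real.exp (-(d / 512))) := by
  induction j with
  | zero =>
    intro l A B R hl hAB hABR h
    have : {G : SimpleGraph V | ((explore G 0 A B R).card : ℝ) < d ^ (l + 0) / 2} = ∅ := by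
      ext G
      simpa [explore] using h.half_le hd16 hl
    rw [this]; simp
  | succ j ih =>
    intro l A B R hl hAB hABR h
    have hl2 : 40 * d ^ (l + 2) ≤ Fintype.card V := by
      have : d ^ (l + 2) ≤ d ^ (l + (j + 1) + 1) := pow_le_pow_right₀ (by linarith) (by omega)
      linarith
    have hl' : 40 * d ^ (l + 1 + j + 1) ≤ Fintype.card V := by
      rwa [show l + 1 + j + 1 = l + (j + 1) + 1 by ring]
    have hb := binomialRandom_bind_le (p := p) (τ := Finset V × Finset V)
      (F := {e | ∃ x ∈ A ∪ B, ∃ w ∈ R, e = s(x, w)}) (F' := {e | ∃ x ∈ R, ∃ y ∈ R, e = s(x, y)})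
      ?_ (T := fun G => (neighborsIn G A (R \ neighborsIn G B R), neighborsIn G B R)) ?_
      (fun t => {G | ((explore G j t.1 t.2 ((R \ t.2) \ t.1)).card : ℝ) < d ^ (l + (j + 1)) / 2})
      {t | LayerSizes d (l + 1) t.1 t.2 ((R \ t.2) \ t.1)} (δ := j * (3 * Real.exp (-(d / 512))))
      (by positivity) ?_
    · refine hb.trans ?_
      have := measureReal_not_layerSizes_step_le p hd hd16 hl2 hAB hABR h
      push_cast
      rw [add_mul, one_mul, add_comm]
      exact add_le_add_right this _
    · rw [Set.disjoint_left]
      rintro e ⟨x, hx, w, hw, rfl⟩ ⟨x', hx', y', hy', he⟩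
      have hxR : x ∉ R := Finset.disjoint_left.1 hABR hx
      rcases Sym2.eq_iff.1 he with ⟨h, -⟩ | ⟨h, -⟩
      · exact hxR (h ▸ hx')
      · exact hxR (h ▸ hy')
    · intro t G H hGH hG
      have hadj : ∀ x ∈ A ∪ B, ∀ w ∈ R, G.Adj x w ↔ H.Adj x w := fun x hx w hw => by
        simpa using hGH s(x, w) ⟨x, hx, w, hw, rfl⟩
      have hB : neighborsIn G B R = neighborsIn H B R :=
        neighborsIn_congr fun x hx w hw => hadj x (by simp [hx]) w hw
      have hA : neighborsIn G A (R \ neighborsIn H B R) = neighborsIn H A (R \ neighborsIn H B R) :=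
        neighborsIn_congr fun x hx w hw => hadj x (by simp [hx]) w (Finset.mem_sdiff.1 hw).1
      rw [Set.mem_ofPred_eq] at hG ⊢
      rwa [hB, hA] at hG
    · rintro t ht ⟨G, rfl⟩
      set B' := neighborsIn G B R with hB'
      set A' := neighborsIn G A (R \ B') with hA'
      have hB'R : B' ⊆ R := fun w hw => (mem_neighborsIn.1 hw).1
      have hA'R : A' ⊆ R \ B' := fun w hw => (mem_neighborsIn.1 hw).1
      constructor
      · exact eventDependsOn_explore j (hA'R.trans Finset.sdiff_subset) hB'R
          (Finset.sdiff_subset.trans Finset.sdiff_subset) (fun X => (X.card : ℝ) < d ^ (l + (j + 1)) / 2)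
      · have := ih hl' (A := A') (B := B') (R := (R \ B') \ A')
          (Finset.disjoint_of_subset_left hA'R Finset.sdiff_disjoint) ?_ ht
        · rwa [show l + 1 + j = l + (j + 1) by ring] at this
        · rw [Finset.disjoint_union_left]
          refine ⟨Finset.disjoint_sdiff, ?_⟩
          exact Finset.disjoint_of_subset_right Finset.sdiff_subset Finset.disjoint_sdiff

open scoped Classical in
theorem measureReal_not_layerSizes_init_le (p : I) {d : ℝ} (hd : d = Fintype.card V * p)
    (hd16 : 16 ≤ d) {u v : V} :
    (binomialRandom V p).real {G | ¬ LayerSizes d 0 {u} (neighborsIn G {v} (Finset.univ \ {u, v}))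
      ((Finset.univ \ {u, v}) \ neighborsIn G {v} (Finset.univ \ {u, v}))} ≤
      Real.exp (-(d / 512)) := by
  set R : Finset V := Finset.univ \ {u, v} with hR
  have hp0 : (0 : ℝ) ≤ p := p.2.1
  have hRn : (R.card : ℝ) ≤ Fintype.card V := by exact_mod_cast Finset.card_le_univ R
  have hch := measureReal_card_neighborsIn_ge_le p (X := {v}) (R := R) (m := d) (ε := 1 / 2)
    (by simp [hR]) (by rw [hd, mul_comm (Fintype.card V : ℝ)]; simp; gcongr) (by norm_num)
    (by norm_num)
  refine (measureReal_mono ?_).trans (hch.trans (Real.exp_le_exp.2 (by linarith)))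
  intro G hG
  by_contra hcon
  rw [Set.mem_ofPred_eq, not_le] at hcon
  apply hG
  have hR2 : (Fintype.card V : ℝ) ≤ R.card + 2 := by
    have h1 := Finset.card_le_card_sdiff_add_card (s := (Finset.univ : Finset V)) (t := {u, v})
    have h2 : ({u, v} : Finset V).card ≤ 2 := Finset.card_le_two
    rw [Finset.card_univ, ← hR] at h1
    exact_mod_cast (by omega : Fintype.card V ≤ R.card + 2)
  have hR3 : (R.card : ℝ) ≤ (R \ neighborsIn G {v} R).card + (neighborsIn G {v} R).card := by
    exact_mod_cast Finset.card_le_card_sdiff_add_card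
  refine ⟨?_, ?_, ?_, ?_⟩
  · simp; positivity
  · simp; norm_num
  · norm_num; linarith
  · norm_num; linarith

open scoped Classical in
/-- With high probability, non-adjacent vertices `u` and `v` are distinguished by many
vertices. -/
theorem measureReal_few_closerByTwo_le (p : I) {d : ℝ} (hd : d = Fintype.card V * p)
    (hd16 : 16 ≤ d) {k : ℕ} (hk : 40 * d ^ (k + 1) ≤ Fintype.card V) {u v : V} (hne : u ≠ v) :
    (binomialRandom V p).real {G | ¬ G.Adj u v ∧
      ((Finset.univ.filter fun x => CloserByTwo G u v x ∧ G.edist u x ≠ ⊤).card : ℝ) < d ^ k / 2} ≤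
      (3 * k + 1) * Real.exp (-(d / 512)) := by
  set R : Finset V := Finset.univ \ {u, v} with hR
  have hvR : v ∉ R := by simp [hR]
  have hsub : {G : SimpleGraph V | ¬ G.Adj u v ∧
      ((Finset.univ.filter fun x => CloserByTwo G u v x ∧ G.edist u x ≠ ⊤).card : ℝ) < d ^ k / 2} ⊆
      {G | ((explore G k {u} (neighborsIn G {v} R) (R \ neighborsIn G {v} R)).card : ℝ) <
        d ^ k / 2} := by
    rintro G ⟨hG1, hG2⟩
    refine lt_of_le_of_lt ?_ hG2
    exact_mod_cast Finset.card_le_card fun x hx =>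
      Finset.mem_filter.2 ⟨Finset.mem_univ _, (exploreInvariant_init hne hG1).mem_explore k x hx⟩
  -- The edges from `v` into `R` are exposed to give the first layer; the rest of the search lives
  -- on `insert u R`, which omits `v`.
  have hb := binomialRandom_bind_le (p := p) (τ := Finset V)
    (F := {e | ∃ w ∈ R, e = s(v, w)})
    (F' := {e | ∃ x ∈ insert u R, ∃ y ∈ insert u R, e = s(x, y)})
    ?_ (T := fun G => neighborsIn G {v} R) ?_
    (fun t => {G | ((explore G k {u} t (R \ t)).card : ℝ) < d ^ k / 2})
    {t | LayerSizes d 0 {u} t (R \ t)} (δ := k * (3 * Real.exp (-(d / 512))))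
    (by positivity) ?_
  · refine (measureReal_mono hsub).trans (hb.trans ?_)
    have := measureReal_not_layerSizes_init_le p hd hd16 (u := u) (v := v)
    calc _ ≤ Real.exp (-(d / 512)) + k * (3 * Real.exp (-(d / 512))) := add_le_add_left this _
      _ = _ := by ring
  · rw [Set.disjoint_left]
    rintro e ⟨w, hw, rfl⟩ ⟨x', hx', y', hy', he⟩
    have hv : v ∉ insert u R := by simp [hvR, hne.symm]
    rcases Sym2.eq_iff.1 he with ⟨h, -⟩ | ⟨h, -⟩
    · exact hv (h ▸ hx')
    · exact hv (h ▸ hy')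
  · intro t G H hGH hG
    have hB : neighborsIn G {v} R = neighborsIn H {v} R := by
      refine neighborsIn_congr fun x hx w hw => ?_
      rw [Finset.mem_singleton] at hx
      subst hx
      simpa using hGH s(x, w) ⟨w, hw, rfl⟩
    rw [Set.mem_ofPred_eq] at hG ⊢
    rwa [hB] at hG
  · rintro t ht ⟨G, rfl⟩
    have hBR : neighborsIn G {v} R ⊆ R := fun w hw => (mem_neighborsIn.1 hw).1
    have huR : u ∉ R := by simp [hR]
    constructor
    · exact eventDependsOn_explore k (by simp) (hBR.trans (Finset.subset_insert _ _))
        (Finset.sdiff_subset.trans (Finset.subset_insert _ _)) (fun X => (X.card : ℝ) < d ^ k / 2)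
    · have := measureReal_card_explore_lt_le p hd hd16 k (l := 0) (by simpa using hk)
        (Finset.disjoint_singleton_left.2 fun h => huR (hBR h)) ?_ ht
      · simpa using this
      · rw [Finset.disjoint_union_left]
        refine ⟨Finset.disjoint_singleton_left.2 fun h => huR (Finset.mem_sdiff.1 h).1, ?_⟩
        exact Finset.disjoint_sdiff

end Landmarks

/-! ### The landmark algorithm: correctness and query count. -/

namespace DistanceQueryAlgorithm

variable {V : Type}

open scoped Classical in
/-- Ask all the queries in a list, record the answers as a function, and continue. -/
noncomputable def askAll (next : (V × V → ℕ∞) → DistanceQueryAlgorithm V) :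
    List (V × V) → (V × V → ℕ∞) → DistanceQueryAlgorithm V
  | [], f => next f
  | q :: l, f => query q.1 q.2 fun a => askAll next l (Function.update f q a)

open scoped Classical in
/-- The answers recorded after asking the queries in `l`. -/
noncomputable def answers (G : SimpleGraph V) (l : List (V × V)) (f : V × V → ℕ∞) (q : V × V) :
    ℕ∞ :=
  if q ∈ l then G.edist q.1 q.2 else f q

open scoped Classical in
theorem answers_cons (G : SimpleGraph V) (q : V × V) (l : List (V × V)) (f : V × V → ℕ∞) :
    answers G l (Function.update f q (G.edist q.1 q.2)) = answers G (q :: l) f := by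
  ext r
  by_cases h1 : r ∈ l <;> by_cases h2 : r = q <;> simp [answers, h1, h2]

theorem answers_nil (G : SimpleGraph V) (f : V × V → ℕ∞) : answers G [] f = f := by
  ext r
  simp [answers]

theorem run_askAll (G : SimpleGraph V) (next : (V × V → ℕ∞) → DistanceQueryAlgorithm V)
    (l : List (V × V)) : ∀ f, run G (askAll next l f) = run G (next (answers G l f)) := by
  induction l with
  | nil => intro f; rw [askAll, answers_nil]
  | cons q l ih => intro f; rw [askAll, run, ih, ← answers_cons]

theorem numQueries_askAll (G : SimpleGraph V) (next : (V × V → ℕ∞) → DistanceQueryAlgorithm V)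
    (l : List (V × V)) :
    ∀ f, numQueries G (askAll next l f) = l.length + numQueries G (next (answers G l f)) := by
  induction l with
  | nil => intro f; rw [askAll, answers_nil, List.length_nil, zero_add]
  | cons q l ih =>
    intro f
    rw [askAll, numQueries, ih, ← answers_cons, List.length_cons, add_right_comm]

/-- The distances to the landmarks do not rule out that two vertices are adjacent. -/
def IsCandidate {m : ℕ} (S : Fin m → V) (f : V × V → ℕ∞) (q : V × V) : Prop :=
  q.1 ≠ q.2 ∧ ∀ i, f (q.1, S i) ≤ f (q.2, S i) + 1 ∧ f (q.2, S i) ≤ f (q.1, S i) + 1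

open SimpleGraph in
theorem IsCandidate.of_adj {m : ℕ} (S : Fin m → V) {G : SimpleGraph V} {u v : V}
    (h : G.Adj u v) : IsCandidate S (fun r => G.edist r.1 r.2) (u, v) := by
  refine ⟨h.ne, fun i => ⟨?_, ?_⟩⟩
  · calc G.edist u (S i) ≤ G.edist u v + G.edist v (S i) := G.edist_triangle
      _ = _ := by rw [edist_eq_one_iff_adj.2 h, add_comm]
  · calc G.edist v (S i) ≤ G.edist v u + G.edist u (S i) := G.edist_triangle
      _ = _ := by rw [edist_eq_one_iff_adj.2 h.symm, add_comm]

variable [Fintype V]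

/-- The queries from every vertex to every landmark. -/
noncomputable def landmarkQueries {m : ℕ} (S : Fin m → V) : List (V × V) :=
  (Finset.univ : Finset (V × Fin m)).toList.map fun x => (x.1, S x.2)

open scoped Classical in
/-- Query all distances to the landmarks, then all pairs that may still be adjacent. -/
noncomputable def landmarkAlgorithm {m : ℕ} (S : Fin m → V) : DistanceQueryAlgorithm V :=
  -- The default answer `⊤` in the second phase makes every pair that is not queried count as
  -- non-adjacent.
  askAll (fun f => askAll (fun g => output (SimpleGraph.fromRel fun u v => g (u, v) = 1))
    (Finset.univ.filter (IsCandidate S f)).toList fun _ => ⊤) (landmarkQueries S) fun _ => ⊤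

theorem isCandidate_answers_iff {m : ℕ} (S : Fin m → V) (G : SimpleGraph V) (q : V × V) :
    IsCandidate S (answers G (landmarkQueries S) fun _ => ⊤) q ↔
      IsCandidate S (fun r => G.edist r.1 r.2) q := by
  have : ∀ v i, answers G (landmarkQueries S) (fun _ => ⊤) (v, S i) = G.edist v (S i) := by
    intro v i
    rw [answers, if_pos]
    exact List.mem_map.2 ⟨(v, i), by simp, rfl⟩
  simp [IsCandidate, this]

theorem run_landmarkAlgorithm {m : ℕ} (S : Fin m → V) (G : SimpleGraph V) :
    (landmarkAlgorithm S).run G = G := by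
  classical
  rw [landmarkAlgorithm, run_askAll, run_askAll, run]
  have key : ∀ u v, u ≠ v → (answers G (Finset.univ.filter (IsCandidate S
      (answers G (landmarkQueries S) fun _ => ⊤))).toList (fun _ => ⊤) (u, v) = 1 ↔ G.Adj u v) := by
    intro u v huv
    rw [answers]
    split_ifs with h
    · exact SimpleGraph.edist_eq_one_iff_adj
    · simp only [Finset.mem_toList, Finset.mem_filter, Finset.mem_univ, true_and,
        isCandidate_answers_iff] at h
      simp only [ENat.top_ne_one, false_iff]
      exact fun hadj => h (IsCandidate.of_adj S hadj)
  ext u v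
  rw [SimpleGraph.fromRel_adj]
  constructor
  · rintro ⟨hne, h | h⟩
    · exact (key u v hne).1 h
    · exact ((key v u hne.symm).1 h).symm
  · exact fun h => ⟨h.ne, Or.inl ((key u v h.ne).2 h)⟩

open scoped Classical in
theorem numQueries_landmarkAlgorithm {m : ℕ} (S : Fin m → V) (G : SimpleGraph V) :
    (landmarkAlgorithm S).numQueries G = Fintype.card V * m +
      (Finset.univ.filter (IsCandidate S fun r => G.edist r.1 r.2)).card := by
  rw [landmarkAlgorithm, numQueries_askAll, numQueries_askAll, numQueries, landmarkQueries]
  simp only [List.length_map, Finset.length_toList, Finset.card_univ, Fintype.card_prod,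
    Fintype.card_fin, add_zero]
  congr 2
  ext q
  simp only [Finset.mem_filter, Finset.mem_univ, true_and]
  exact isCandidate_answers_iff S G q

end DistanceQueryAlgorithm

/-! ### Averaging over the landmarks. -/

section Averaging

open MeasureTheory ProbabilityTheory SimpleGraph unitInterval DistanceQueryAlgorithm

theorem sum_measureReal_le_of_card_le {Ω ι : Type*} [MeasurableSpace Ω] {μ : Measure Ω}
    [IsProbabilityMeasure μ] [Fintype ι] {E : ι → Set Ω} (hE : ∀ i, MeasurableSet (E i)) {c : ℝ}
    (h : ∀ ω, ∑ i, (E i).indicator (1 : Ω → ℝ) ω ≤ c) : ∑ i, μ.real (E i) ≤ c := by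
  have hint : ∀ i ∈ Finset.univ, Integrable ((E i).indicator (1 : Ω → ℝ)) μ := fun i _ =>
    (integrable_const (1 : ℝ)).indicator (hE i)
  calc ∑ i, μ.real (E i) = ∑ i, ∫ ω, (E i).indicator (1 : Ω → ℝ) ω ∂μ :=
        Finset.sum_congr rfl fun i _ => (integral_indicator_one (hE i)).symm
    _ = ∫ ω, ∑ i, (E i).indicator (1 : Ω → ℝ) ω ∂μ := (integral_finsetSum _ hint).symm
    _ ≤ ∫ _, c ∂μ := integral_mono (integrable_finsetSum _ hint) (integrable_const _) h
    _ = c := by simp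

variable {V : Type}

theorem expectedQueries_pure (A : DistanceQueryAlgorithm V) (μ : Measure (SimpleGraph V)) :
    RandomizedDistanceQueryAlgorithm.expectedQueries (PMF.pure A) μ =
      ∫⁻ G, (A.numQueries G : ℝ≥0∞) ∂μ := by
  rw [RandomizedDistanceQueryAlgorithm.expectedQueries, tsum_eq_single A]
  · simp
  · intro B hB
    simp [PMF.pure_apply, hB]

variable [Fintype V]

open scoped Classical in
-- The pair survives only if every landmark avoids the distinguishing set, which leaves at most `(n
-- - D) ^ m` tuples.
theorem card_isCandidate_le {m : ℕ} {G : SimpleGraph V} {u v : V} (hn : 0 < Fintype.card V) {D : ℝ}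
    (hD : D ≤ (Finset.univ.filter fun x => CloserByTwo G u v x ∧ G.edist u x ≠ ⊤).card) :
    ((Finset.univ.filter fun S : Fin m → V =>
      IsCandidate S (fun r => G.edist r.1 r.2) (u, v)).card : ℝ) ≤
      (Fintype.card V : ℝ) ^ m * Real.exp (-(m * (D / Fintype.card V))) := by
  set F := Finset.univ.filter fun x => CloserByTwo G u v x ∧ G.edist u x ≠ ⊤ with hF
  have hn' : (0 : ℝ) < Fintype.card V := by exact_mod_cast hn
  have hsub : (Finset.univ.filter fun S : Fin m → V =>
      IsCandidate S (fun r => G.edist r.1 r.2) (u, v)) ⊆ Fintype.piFinset fun _ => Fᶜ := by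
    intro S hS
    rw [Finset.mem_filter] at hS
    rw [Fintype.mem_piFinset]
    intro i
    simp only [hF, Finset.mem_compl, Finset.mem_filter, Finset.mem_univ, true_and, not_and]
    intro hc htop
    have h1 : G.edist u (S i) + 2 ≤ G.edist u (S i) + 1 := hc.trans (hS.2.2 i).2
    obtain ⟨a, ha⟩ := ENat.ne_top_iff_exists.1 htop
    rw [← ha] at h1
    have : a + 2 ≤ a + 1 := by exact_mod_cast h1
    omega
  have hcard : ((Fᶜ).card : ℝ) ≤ Fintype.card V * Real.exp (-(D / Fintype.card V)) := by
    have h1 : ((Fᶜ).card : ℝ) = Fintype.card V - F.card := by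
      have := Finset.card_compl_add_card F
      rw [eq_sub_iff_add_eq]; exact_mod_cast this
    have h2 := Real.add_one_le_exp (-(D / Fintype.card V))
    calc ((Fᶜ).card : ℝ) ≤ Fintype.card V - D := by rw [h1]; linarith
      _ = Fintype.card V * (-(D / Fintype.card V) + 1) := by field_simp; ring
      _ ≤ _ := by gcongr
  calc _ ≤ ((Fintype.piFinset fun _ : Fin m => Fᶜ).card : ℝ) := by
        exact_mod_cast Finset.card_le_card hsub
    _ = ((Fᶜ).card : ℝ) ^ m := by simp
    _ ≤ (Fintype.card V * Real.exp (-(D / Fintype.card V))) ^ m := by gcongr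
    _ = _ := by rw [mul_pow, ← Real.exp_nat_mul]; ring_nf

open scoped Classical in
-- A pair survives because it is an edge (`p`), because too few vertices distinguish it (`δ`), or
-- because the landmarks miss all of those (the exponential). The last cost is averaged over all
-- tuples for each fixed graph, then the two sums are exchanged.
theorem exists_landmarks_sum_le (p : I) (m : ℕ) (hn : 0 < Fintype.card V) {D δ : ℝ} (hδ : 0 ≤ δ)
    (hbad : ∀ u v : V, u ≠ v → (binomialRandom V p).real {G | ¬ G.Adj u v ∧
      ((Finset.univ.filter fun x => CloserByTwo G u v x ∧ G.edist u x ≠ ⊤).card : ℝ) < D} ≤ δ) :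
    ∃ S : Fin m → V, ∑ q : V × V,
      (binomialRandom V p).real {G | IsCandidate S (fun r => G.edist r.1 r.2) q} ≤
        (Fintype.card V : ℝ) ^ 2 * (p + δ + Real.exp (-(m * (D / Fintype.card V)))) := by
  set μ := binomialRandom V p
  set η := Real.exp (-(m * (D / Fintype.card V))) with hη
  have hp0 : (0 : ℝ) ≤ p := p.2.1
  have hpair : ∀ q : V × V, ∑ S : Fin m → V,
      μ.real {G | IsCandidate S (fun r => G.edist r.1 r.2) q} ≤
        (Fintype.card V : ℝ) ^ m * (p + δ + η) := by
    rintro ⟨u, v⟩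
    by_cases huv : u = v
    · have : ∀ S : Fin m → V, {G : SimpleGraph V |
          IsCandidate S (fun r => G.edist r.1 r.2) (u, v)} = ∅ := by
        intro S; ext G; simp [IsCandidate, huv]
      simp only [this, measureReal_empty, Finset.sum_const_zero]
      positivity
    set Bad : Set (SimpleGraph V) := {G | ¬ G.Adj u v ∧
      ((Finset.univ.filter fun x => CloserByTwo G u v x ∧ G.edist u x ≠ ⊤).card : ℝ) < D} with hBad
    set E : (Fin m → V) → Set (SimpleGraph V) := fun S =>
      {G | IsCandidate S (fun r => G.edist r.1 r.2) (u, v) ∧ G ∉ Bad ∧ ¬ G.Adj u v} with hE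
    have h1 : ∀ S : Fin m → V, μ.real {G | IsCandidate S (fun r => G.edist r.1 r.2) (u, v)} ≤
        p + δ + μ.real (E S) := by
      intro S
      have hsub : {G | IsCandidate S (fun r => G.edist r.1 r.2) (u, v)} ⊆
          {G | G.Adj u v} ∪ Bad ∪ E S := by
        intro G hG
        by_cases hA : G.Adj u v
        · exact Or.inl (Or.inl hA)
        by_cases hB : G ∈ Bad
        · exact Or.inl (Or.inr hB)
        exact Or.inr ⟨hG, hB, hA⟩
      have i1 := measureReal_union_le (μ := μ) ({G | G.Adj u v} ∪ Bad) (E S)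
      have i2 := measureReal_union_le (μ := μ) {G | G.Adj u v} Bad
      have i3 : μ.real {G | G.Adj u v} = p := binomialRandom_adj huv
      have i4 := hbad u v huv
      have i5 := measureReal_mono (μ := μ) hsub
      linarith
    have h2 : ∑ S, μ.real (E S) ≤ (Fintype.card V : ℝ) ^ m * η := by
      refine sum_measureReal_le_of_card_le (fun S => .of_discrete) fun G => ?_
      by_cases hG : G ∉ Bad ∧ ¬ G.Adj u v
      · have hDG : D ≤ (Finset.univ.filter fun x => CloserByTwo G u v x ∧ G.edist u x ≠ ⊤).card := by
          by_contra hlt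
          exact hG.1 ⟨hG.2, lt_of_not_ge hlt⟩
        refine le_trans (le_of_eq ?_) (card_isCandidate_le hn hDG)
        simp [hE, Set.indicator_apply, hG.1, hG.2, Finset.sum_boole]
      · have : ∀ S, G ∉ E S := fun S hS => hG hS.2
        simp only [Set.indicator_of_notMem (this _), Finset.sum_const_zero]
        positivity
    calc _ ≤ ∑ S : Fin m → V, (p + δ + μ.real (E S)) := Finset.sum_le_sum fun S _ => h1 S
      _ = (Fintype.card V : ℝ) ^ m * (p + δ) + ∑ S, μ.real (E S) := by
          rw [Finset.sum_add_distrib]; simp [mul_add]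
      _ ≤ _ := by rw [mul_add _ ((p : ℝ) + δ)]; gcongr
  have hne : Nonempty V := Fintype.card_pos_iff.1 hn
  -- If every tuple exceeded the bound, so would the sum over all tuples.
  by_contra! hcon
  have hlt := Finset.sum_lt_sum_of_nonempty (s := (Finset.univ : Finset (Fin m → V)))
    Finset.univ_nonempty fun S _ => hcon S
  rw [Finset.sum_comm] at hlt
  have hle := Finset.sum_le_sum fun q (_ : q ∈ (Finset.univ : Finset (V × V))) => hpair q
  have := hlt.trans_le hle
  simp only [Finset.sum_const, Finset.card_univ, Fintype.card_prod, Fintype.card_fun,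
    Fintype.card_fin, nsmul_eq_mul, Nat.cast_mul, Nat.cast_pow] at this
  refine this.ne ?_
  ring

theorem lintegral_numQueries_landmarkAlgorithm (p : I) {m : ℕ} (S : Fin m → V) :
    ∫⁻ G, ((landmarkAlgorithm S).numQueries G : ℝ≥0∞) ∂(binomialRandom V p) =
      ENNReal.ofReal (Fintype.card V * m + ∑ q : V × V,
        (binomialRandom V p).real {G | IsCandidate S (fun r => G.edist r.1 r.2) q}) := by
  classical
  have h1 : ∀ G, ((landmarkAlgorithm S).numQueries G : ℝ≥0∞) = (Fintype.card V * m : ℕ) +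
      ∑ q : V × V, {G | IsCandidate S (fun r => G.edist r.1 r.2) q}.indicator 1 G := by
    intro G
    rw [numQueries_landmarkAlgorithm]
    simp [Set.indicator_apply, Finset.sum_boole]
  simp_rw [h1]
  rw [lintegral_add_left measurable_const, lintegral_finsetSum _ fun _ _ => .of_discrete,
    ENNReal.ofReal_add (by positivity) (Finset.sum_nonneg fun _ _ => measureReal_nonneg),
    ENNReal.ofReal_sum_of_nonneg fun _ _ => measureReal_nonneg]
  congr 1
  · rw [← Nat.cast_mul, ENNReal.ofReal_natCast]
    simp
  · refine Finset.sum_congr rfl fun q _ => ?_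
    rw [lintegral_indicator_one .of_discrete]
    simp

end Averaging

/-! ### Choice of the number of rounds, and the failure probability. -/

section Parameters

theorem exists_pow_le_lt_pow {n d : ℝ} (hd : 2 ≤ d) (h : 40 * d ≤ n) :
    ∃ k : ℕ, 40 * d ^ (k + 1) ≤ n ∧ n < 40 * d ^ (k + 2) := by
  classical
  have hex : ∃ j : ℕ, n < 40 * d ^ (j + 1) := by
    obtain ⟨j, hj⟩ := pow_unbounded_of_one_lt n (show 1 < d by linarith)
    refine ⟨j, hj.trans_le ?_⟩
    rw [pow_succ]
    have : 0 < d ^ j := by positivity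
    nlinarith
  have hpos : Nat.find hex ≠ 0 := by
    intro h0
    have := Nat.find_spec hex
    rw [h0] at this
    simp at this
    linarith
  obtain ⟨k, hk⟩ := Nat.exists_eq_succ_of_ne_zero hpos
  refine ⟨k, ?_, ?_⟩
  · exact not_lt.1 (Nat.find_min hex (m := k) (by omega))
  · have := Nat.find_spec hex
    rwa [hk] at this

/-- The constant 2000 exceeds `3 * 512`, so the exponential is at most `n ^ (-3)`, while `k + 1 ≤ 2
^ (k + 1) ≤ n / 40` controls the number of rounds. -/
theorem three_mul_exp_le {n d : ℝ} {k : ℕ} (hn : 3 ≤ n) (hd : 2000 * Real.log n ≤ d) (hd2 : 2 ≤ d)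
    (hk : 40 * d ^ (k + 1) ≤ n) : (3 * k + 1) * Real.exp (-(d / 512)) ≤ 1 / n := by
  have hn0 : 0 < n := by linarith
  have hlog : 0 ≤ Real.log n := Real.log_nonneg (by linarith)
  have h1 : ((k + 1 : ℕ) : ℝ) ≤ d ^ (k + 1) := by
    calc ((k + 1 : ℕ) : ℝ) ≤ (2 : ℝ) ^ (k + 1) := by exact_mod_cast (Nat.lt_two_pow_self).le
      _ ≤ _ := by gcongr
  have h2 : Real.exp (-(d / 512)) ≤ (n ^ 3)⁻¹ := by
    calc Real.exp (-(d / 512)) ≤ Real.exp (-((3 : ℕ) * Real.log n)) := by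
          rw [Real.exp_le_exp]; push_cast; linarith
      _ = (n ^ 3)⁻¹ := by rw [Real.exp_neg, Real.exp_nat_mul, Real.exp_log hn0]
  push_cast at h1
  calc (3 * k + 1) * Real.exp (-(d / 512)) ≤ n * (n ^ 3)⁻¹ := by
        gcongr
        linarith
    _ = 1 / n * (1 / n) := by field_simp
    _ ≤ 1 / n := mul_le_of_le_one_right (by positivity) (by rw [div_le_one hn0]; linarith)

end Parameters

/-! ### Assembly of the theorem. -/

open SimpleGraph DistanceQueryAlgorithm in
theorem exists_algorithm_of_two_thousand_le_log {n : ℕ} (hL : 2000 ≤ Real.log n) (p : unitInterval)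
    (hp1 : 2000 * Real.log n / n ≤ (p : ℝ)) (hp2 : (p : ℝ) ≤ Real.log n ^ 2 / n) :
    ∃ A : RandomizedDistanceQueryAlgorithm (Fin n),
      RandomizedDistanceQueryAlgorithm.Reconstructs A ∧
      RandomizedDistanceQueryAlgorithm.expectedQueries A (binomialRandom (Fin n) p) ≤
        ENNReal.ofReal (100 * (n * Real.log n ^ 5)) := by
  have hn0 : 0 < n := by
    rcases Nat.eq_zero_or_pos n with rfl | h
    · simp at hL; linarith
    · exact h
  have hN0 : (0 : ℝ) < n := by exact_mod_cast hn0
  set L := Real.log n with hLdef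
  have hexp : Real.exp L = n := Real.exp_log hN0
  have hL3 : L ^ 3 / 6 ≤ n := by
    rw [← hexp]
    simpa [Nat.factorial] using Real.pow_div_factorial_le_exp L (by linarith) 3
  obtain ⟨d, hd⟩ : ∃ d : ℝ, d = (n : ℝ) * p := ⟨_, rfl⟩
  have hd1 : 2000 * L ≤ d := by
    rw [hd, mul_comm (n : ℝ)]; exact (div_le_iff₀ hN0).1 hp1
  have hd2 : d ≤ L ^ 2 := by
    rw [hd, mul_comm]; exact (le_div_iff₀ hN0).1 hp2
  have hL40 : 40 * L ^ 2 ≤ n := by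
    refine le_trans ?_ hL3
    nlinarith [mul_nonneg (sq_nonneg L) (show 0 ≤ L - 240 by linarith)]
  obtain ⟨k, hk1, hk2⟩ := exists_pow_le_lt_pow (n := n) (d := d) (by linarith) (by linarith)
  have hn3 : (3 : ℝ) ≤ n := by nlinarith
  -- Maximality of `k` gives `n ≤ 80 * L ^ 4 * (d ^ k / 2)`; one more factor `L` makes the
  -- probability of missing at most `exp (-L) = 1 / n`.
  obtain ⟨m, hm⟩ : ∃ m : ℕ, m = ⌈80 * L ^ 5⌉₊ := ⟨_, rfl⟩
  have hm1 : 80 * L ^ 5 ≤ m := hm ▸ Nat.le_ceil _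
  have hm2 : (m : ℝ) ≤ 80 * L ^ 5 + 1 := by
    rw [hm]; exact (Nat.ceil_lt_add_one (by positivity)).le
  obtain ⟨S, hS⟩ := exists_landmarks_sum_le (V := Fin n) p m (by simpa using hn0) (D := d ^ k / 2)
    (δ := 1 / n) (by positivity) fun u v huv =>
      (measureReal_few_closerByTwo_le p (by simpa using hd) (by linarith) (by simpa using hk1)
        huv).trans (three_mul_exp_le hn3 hd1 (by linarith) hk1)
  rw [Fintype.card_fin] at hS
  have hη : Real.exp (-(m * (d ^ k / 2 / n))) ≤ 1 / n := by
    rw [← hexp, one_div, ← Real.exp_neg, Real.exp_le_exp, neg_le_neg_iff, hexp]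
    have hd0 : 0 < d := by linarith
    have hdk : 0 < d ^ k := by positivity
    have h1 : (n : ℝ) ≤ 80 * L ^ 4 * (d ^ k / 2) := by
      calc (n : ℝ) ≤ 40 * d ^ (k + 2) := hk2.le
        _ = 80 * d ^ 2 * (d ^ k / 2) := by ring
        _ ≤ 80 * (L ^ 2) ^ 2 * (d ^ k / 2) := by gcongr
        _ = _ := by ring
    rw [← mul_div_assoc, le_div_iff₀ hN0]
    calc L * n ≤ L * (80 * L ^ 4 * (d ^ k / 2)) := by gcongr
      _ = 80 * L ^ 5 * (d ^ k / 2) := by ring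
      _ ≤ _ := by gcongr
  refine ⟨PMF.pure (landmarkAlgorithm S), ?_, ?_⟩
  · intro D hD G
    rw [PMF.support_pure, Set.mem_singleton_iff] at hD
    rw [hD, run_landmarkAlgorithm]
  · rw [expectedQueries_pure, lintegral_numQueries_landmarkAlgorithm, Fintype.card_fin]
    refine ENNReal.ofReal_le_ofReal ?_
    have h1 : (n : ℝ) ^ 2 * (p + 1 / n + Real.exp (-(m * (d ^ k / 2 / n)))) ≤ n * (L ^ 2 + 2) := by
      calc _ ≤ (n : ℝ) ^ 2 * (p + 1 / n + 1 / n) := by gcongr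
        _ = n * (d + 2) := by rw [hd]; field_simp; ring
        _ ≤ _ := by gcongr
    have h2 : (1 : ℝ) ≤ L ^ 5 := one_le_pow₀ (by linarith)
    have h3 : L ^ 2 ≤ L ^ 5 := pow_le_pow_right₀ (by linarith) (by norm_num)
    calc (n : ℝ) * m + _ ≤ n * (80 * L ^ 5 + 1) + n * (L ^ 2 + 2) := by
          gcongr
          exact hS.trans h1
      _ = n * (80 * L ^ 5 + 1 + L ^ 2 + 2) := by ring
      _ ≤ n * (100 * L ^ 5) := by gcongr; linarith
      _ = _ := by ring

theorem mainTheorem3 :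
    ∃ C : ℝ, 0 < C ∧ ∀ n : ℕ, 1 ≤ n → ∀ p : unitInterval,
      2000 * Real.log n / n ≤ (p : ℝ) → (p : ℝ) ≤ Real.log n ^ 2 / n →
        ∃ A : RandomizedDistanceQueryAlgorithm (Fin n),
          RandomizedDistanceQueryAlgorithm.Reconstructs A ∧
          RandomizedDistanceQueryAlgorithm.expectedQueries A
              (SimpleGraph.binomialRandom (Fin n) p) ≤
            ENNReal.ofReal (C * (n * Real.log n ^ 5)) := by
  refine ⟨100, by norm_num, fun n hn p hp1 hp2 => ?_⟩
  rcases hn.eq_or_lt with rfl | hn2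
  -- For `n = 1` the bound is zero, but there is only one graph, so no query is needed.
  · refine ⟨PMF.pure (.output ⊥), fun D _ G => Subsingleton.elim _ _, ?_⟩
    rw [expectedQueries_pure]
    simp [DistanceQueryAlgorithm.numQueries]
  · have hN : (1 : ℝ) < n := by exact_mod_cast hn2
    have hL : 0 < Real.log n := Real.log_pos hN
    -- For `n ≥ 2` the interval for `p` is nonempty only if `log n ≥ 2000`, so no small cases
    -- remain.
    have h := hp1.trans hp2
    rw [div_le_div_iff_of_pos_right (by linarith), sq] at h
    exact exists_algorithm_of_two_thousand_le_log (le_of_mul_le_mul_right h hL) p hp1 hp2
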